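/- All graphs are finite and simple. A graph $G=(V,E)$ is a unit interval graph if its vertices can be assigned closed intervals of length $1$ on the real line such that two distinct vertices are adjacent if and only if their intervals intersect. The co-claw is the complement of the claw $K_{1,3}$, i.e. the disjoint union of a triangle and a single vertex; a graph is co-claw-free if it has no induced subgraph isomorphic to the co-claw. The chromatic symmetric function of $G$ is the formal power series $$X_G=\sum_{\kappa}\ \prod_{v\in V}x_{\kappa(v)}$$ in variables $x_1,x_2,\dots$, where the sum is over all proper colorings $\kappa:V\to\{1,2,3,\dots\}$ of $G$. For $n \ge 0$ let $e_n=\sum_{j_1<\cdots<j_n}x_{j_1}\cdots x_{j_n}$ (so $e_0=1$), and for an integer partition $\lambda=(\lambda_1\ge\cdots\ge\lambda_\ell)$ let $e_\lambda=e_{\lambda_1}\cdots e_{\lambda_\ell}$ (the empty product being $1$). The graph $G$ is called $e$-positive if $X_G=\sum_\lambda c_\lambda e_\lambda$ for integers $c_\lambda\ge 0$, only finitely many of them nonzero. **Theorem.** Every co-claw-free unit interval graph is $e$-positive. -/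

import Mathlib

noncomputable section

namespace ChromaticSymm

/-- The formal power series `∑ i, x ^ m i` in the variables `x₁, x₂, …` (indexed by the positive
integers), for a family `m` of exponent vectors in which every vector occurs finitely often:
the coefficient of `x ^ α` is the number of indices `i` with `m i = α`. -/
def monomialSum {ι : Type*} (m : ι → (ℕ+ →₀ ℕ)) : MvPowerSeries ℕ+ ℤ :=
  fun α => (Nat.card {i : ι // m i = α} : ℤ)

/-- The exponent vector of the monomial `∏ v, x_{κ v}` attached to a proper coloring `κ`
of `G` with positive integers. -/
def coloringExponent {V : Type*} [Fintype V] {G : SimpleGraph V} (κ : G.Coloring ℕ+) :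
    ℕ+ →₀ ℕ :=
  ∑ v : V, Finsupp.single (κ v) 1

/-- Every monomial comes from finitely many proper colorings. -/
theorem finite_coloringExponent_fiber {V : Type*} [Fintype V] (G : SimpleGraph V)
    (α : ℕ+ →₀ ℕ) : Finite {κ : G.Coloring ℕ+ // coloringExponent κ = α} := by
  classical
  have key : ∀ κ : {κ : G.Coloring ℕ+ // coloringExponent κ = α}, ∀ v, κ.1 v ∈ α.support := by
    rintro ⟨κ, hκ⟩ v
    rw [Finsupp.mem_support_iff]
    intro h
    subst hκ
    change (∑ w : V, Finsupp.single (κ w) 1 : ℕ+ →₀ ℕ) (κ v) = 0 at h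
    rw [Finsupp.finsetSum_apply] at h
    have := (Finset.sum_eq_zero_iff.mp h) v (Finset.mem_univ v)
    simp at this
  refine Finite.of_injective
    (fun κ => (fun v => (⟨κ.1 v, key κ v⟩ : α.support) : V → α.support)) ?_
  intro κ κ' h
  apply Subtype.ext
  apply DFunLike.ext
  intro v
  exact congrArg Subtype.val (congrFun h v)

/-- The chromatic symmetric function `X_G = ∑_κ ∏_v x_{κ v}`, the sum being over all proper
colorings `κ` of the vertices of `G` with positive integers. -/
def chromaticSymmetricFunction {V : Type*} [Fintype V] (G : SimpleGraph V) :
    MvPowerSeries ℕ+ ℤ :=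
  monomialSum (fun κ : G.Coloring ℕ+ => coloringExponent κ)

/-- The exponent vector of the squarefree monomial `∏_{j ∈ s} x_j`. -/
def subsetExponent (s : Finset ℕ+) : ℕ+ →₀ ℕ :=
  ∑ j ∈ s, Finsupp.single j 1

/-- Every monomial comes from at most one finite set of positive integers. -/
theorem subsetExponent_injective : Function.Injective subsetExponent := by
  classical
  intro s t h
  ext j
  have := DFunLike.congr_fun h j
  simp only [subsetExponent, Finsupp.finsetSum_apply, Finsupp.single_apply,
    Finset.sum_ite_eq'] at this
  by_cases hs : j ∈ s <;> by_cases ht : j ∈ t <;> simp_all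

/-- The elementary symmetric function `e_n = ∑_{j₁ < ⋯ < j_n} x_{j₁} ⋯ x_{j_n}`. -/
def elementarySymm (n : ℕ) : MvPowerSeries ℕ+ ℤ :=
  monomialSum (fun s : {s : Finset ℕ+ // s.card = n} => subsetExponent s.1)

/-- `e_λ = e_{λ₁} e_{λ₂} ⋯ e_{λ_ℓ}` for an integer partition `λ`. -/
def elementarySymmPart {n : ℕ} (p : n.Partition) : MvPowerSeries ℕ+ ℤ :=
  (p.parts.map elementarySymm).prod

/-- `f` is `e`-positive: it is a finite linear combination, with nonnegative coefficients, of the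
elementary symmetric functions `e_λ`, where `λ` ranges over all integer partitions. -/
def IsEPositive (f : MvPowerSeries ℕ+ ℤ) : Prop :=
  ∃ c : (Σ n : ℕ, n.Partition) →₀ ℤ,
    (∀ p, 0 ≤ c p) ∧ f = c.sum (fun p a => a • elementarySymmPart p.2)

/-- `G` is a unit interval graph: one can assign to the vertices intervals of length one on the
real line such that distinct vertices are adjacent exactly when their intervals intersect. -/
def IsUnitIntervalGraph {V : Type*} (G : SimpleGraph V) : Prop :=
  ∃ a : V → ℝ, ∀ u v : V, u ≠ v →
    (G.Adj u v ↔ (Set.Icc (a u) (a u + 1) ∩ Set.Icc (a v) (a v + 1)).Nonempty)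

/-- The claw `K_{1,3}`. -/
def claw : SimpleGraph (Fin 1 ⊕ Fin 3) := completeBipartiteGraph (Fin 1) (Fin 3)

/-- The co-claw: the complement of the claw, i.e. a triangle together with an isolated vertex. -/
def coclaw : SimpleGraph (Fin 1 ⊕ Fin 3) := clawᶜ

/-- `G` is co-claw-free: it has no induced subgraph isomorphic to the co-claw. -/
def IsCoclawFree {V : Type*} (G : SimpleGraph V) : Prop :=
  ¬ coclaw.IsIndContained G

end ChromaticSymm

end

noncomputable section

namespace ChromaticSymm

open Finset

/-! ### Formal sums of monomials -/

/-! `X_G` is multiplicative over a vertex set split with no edge across, and e-positivity is closed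
under products, so assume no such split and order the vertices by left endpoint; then consecutive
vertices are adjacent, and an edge `i j` makes everything between `i` and `j` a clique.

If no vertex is adjacent to the one two places later, the graph is a path. Otherwise some `i, i+1,
i+2` form a triangle. Co-claw-freeness makes this triangle dominate, so every earlier vertex is
adjacent to `i` and every later one to `i+2`. A triangle on the first or the last three vertices
therefore covers the graph by two cliques, and every other position forces such a triangle, except
in the five-vertex bull (`mem_ePositive_of_sorted`).

Paths satisfy `P_{n+1} = e_{n+1} + ∑ i e_{i+1} P_{n-i}` (`pathSum_succ`), which is visibly positive.
The bull is an explicit combination of products of path functions (`colorSum_bull`).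

For two cliques, build the graph by adding vertices from right to left. The neighbors of the new
leftmost vertex form a clique, and so do its `d` non-neighbors. By color symmetry its effect on the
coefficients is an operator depending only on `d`, affinely (`coeffQ_option`). On `e_j e_m` the
operator is known for `d = m` and `d = j`, where it merely enlarges one of two disjoint cliques, so
interpolation gives it for every `d`, with nonnegative weights when `j ≤ d ≤ m`
(`addVertex_elemPair`). The products that occur satisfy this bound because the monomial `x_A x_B`
with `A ⊆ B` has positive coefficient and so comes from an actual coloring (`inCone_option`). The
resulting rational coefficients are integers by triangularity (`exists_nat_of_inCone`). -/

/-- Every exponent vector occurs finitely often in the family. -/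
def FiniteFibers {ι : Type*} (m : ι → (ℕ+ →₀ ℕ)) : Prop :=
  ∀ α, Finite {i : ι // m i = α}

theorem FiniteFibers.comp_injective {ι κ : Type*} {m : ι → (ℕ+ →₀ ℕ)} (h : FiniteFibers m)
    {f : κ → ι} (hf : Function.Injective f) : FiniteFibers (m ∘ f) := fun α =>
  have := h α
  Finite.of_injective (fun k : {k : κ // (m ∘ f) k = α} => (⟨f k.1, k.2⟩ : {i // m i = α}))
    (fun _ _ hk => Subtype.ext (hf (congrArg Subtype.val hk)))

theorem FiniteFibers.subtype {ι : Type*} {m : ι → (ℕ+ →₀ ℕ)} (h : FiniteFibers m) (p : ι → Prop) :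
    FiniteFibers (fun i : {i // p i} => m i.1) :=
  h.comp_injective Subtype.val_injective

theorem FiniteFibers.of_injective {ι : Type*} {m : ι → (ℕ+ →₀ ℕ)} (h : Function.Injective m) :
    FiniteFibers m := fun α =>
  have : Subsingleton {i : ι // m i = α} :=
    ⟨fun i j => Subtype.ext (h (i.2.trans j.2.symm))⟩
  inferInstance

theorem coeff_monomialSum {ι : Type*} (m : ι → (ℕ+ →₀ ℕ)) (α : ℕ+ →₀ ℕ) :
    MvPowerSeries.coeff α (monomialSum m) = (Nat.card {i : ι // m i = α} : ℤ) := rfl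

theorem monomialSum_congr {ι κ : Type*} {m : ι → (ℕ+ →₀ ℕ)} {m' : κ → (ℕ+ →₀ ℕ)} (e : ι ≃ κ)
    (h : ∀ i, m' (e i) = m i) : monomialSum m = monomialSum m' := by
  ext α
  rw [coeff_monomialSum, coeff_monomialSum]
  exact congrArg _ (Nat.card_congr (e.subtypeEquiv fun i => by rw [h]))

/-- Finite fibers are essential here: `Nat.card` of an infinite type is `0`, so counts would not
add. -/
theorem monomialSum_split {ι : Type*} {m : ι → (ℕ+ →₀ ℕ)} (hm : FiniteFibers m) (p : ι → Prop) :
    monomialSum m = monomialSum (fun i : {i // p i} => m i.1) +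
      monomialSum (fun i : {i // ¬ p i} => m i.1) := by
  classical
  ext α
  rw [map_add, coeff_monomialSum, coeff_monomialSum, coeff_monomialSum, ← Nat.cast_add]
  have := hm α
  have h1 : Finite {i : {i // p i} // m i.1 = α} := hm.subtype p α
  have h2 : Finite {i : {i // ¬ p i} // m i.1 = α} := hm.subtype (fun i => ¬ p i) α
  rw [← Nat.card_sum]
  refine congrArg _ (Nat.card_congr ?_)
  refine (Equiv.sumCompl (fun i : {i // m i = α} => p i.1)).symm.trans (Equiv.sumCongr ?_ ?_)
  · exact Equiv.subtypeSubtypeEquivSubtypeInter _ _ |>.trans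
      ((Equiv.subtypeEquivRight fun i => and_comm).trans
        (Equiv.subtypeSubtypeEquivSubtypeInter _ _).symm)
  · exact Equiv.subtypeSubtypeEquivSubtypeInter (fun i => m i = α) (fun i => ¬ p i) |>.trans
      ((Equiv.subtypeEquivRight fun i => and_comm).trans
        (Equiv.subtypeSubtypeEquivSubtypeInter (fun i => ¬ p i) (fun i => m i = α)).symm)

theorem monomialSum_mul {ι κ : Type*} {m : ι → (ℕ+ →₀ ℕ)} {m' : κ → (ℕ+ →₀ ℕ)}
    (hm : FiniteFibers m) (hm' : FiniteFibers m') :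
    monomialSum m * monomialSum m' = monomialSum (fun x : ι × κ => m x.1 + m' x.2) := by
  classical
  ext α
  rw [MvPowerSeries.coeff_mul, coeff_monomialSum]
  simp only [coeff_monomialSum]
  have e : {x : ι × κ // m x.1 + m' x.2 = α} ≃
      (Σ p : antidiagonal α, {i // m i = p.1.1} × {j // m' j = p.1.2}) :=
    { toFun := fun x => ⟨⟨(m x.1.1, m' x.1.2), by simpa using x.2⟩, ⟨x.1.1, rfl⟩, ⟨x.1.2, rfl⟩⟩
      invFun := fun y => ⟨(y.2.1.1, y.2.2.1), by
        rw [y.2.1.2, y.2.2.2]; exact mem_antidiagonal.mp y.1.2⟩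
      left_inv := fun x => rfl
      right_inv := by
        rintro ⟨⟨⟨a, b⟩, h⟩, ⟨i, hi⟩, ⟨j, hj⟩⟩
        dsimp at hi hj
        subst hi hj
        rfl }
  have := fun a => hm a
  have := fun a => hm' a
  rw [Nat.card_congr e, Nat.card_sigma]
  simp only [Nat.card_prod]
  push_cast
  exact (Finset.sum_coe_sort (antidiagonal α)
    (fun p => (Nat.card {i // m i = p.1} : ℤ) * (Nat.card {j // m' j = p.2} : ℤ))).symm

theorem FiniteFibers.prod {ι κ : Type*} {m : ι → (ℕ+ →₀ ℕ)} {m' : κ → (ℕ+ →₀ ℕ)}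
    (hm : FiniteFibers m) (hm' : FiniteFibers m') :
    FiniteFibers (fun x : ι × κ => m x.1 + m' x.2) := fun α => by
  classical
  have := fun a => hm a
  have := fun a => hm' a
  refine Finite.of_injective (β := Σ p : antidiagonal α, {i // m i = p.1.1} × {j // m' j = p.1.2})
    (fun x => ⟨⟨(m x.1.1, m' x.1.2), by simpa using x.2⟩, ⟨x.1.1, rfl⟩, ⟨x.1.2, rfl⟩⟩) ?_
  rintro ⟨⟨i, j⟩, h⟩ ⟨⟨i', j'⟩, h'⟩ hx
  rw [Sigma.mk.injEq] at hx
  obtain ⟨h1, h2⟩ := hx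
  simp only [Subtype.mk.injEq, Prod.mk.injEq] at h1
  obtain ⟨h1, h1'⟩ := h1
  have key : ∀ (a a' : ℕ+ →₀ ℕ) (b b' : ℕ+ →₀ ℕ) (x : {i // m i = a} × {j // m' j = b})
      (y : {i // m i = a'} × {j // m' j = b'}), a = a' → b = b' → HEq x y →
      x.1.1 = y.1.1 ∧ x.2.1 = y.2.1 := by
    rintro a a' b b' x y rfl rfl h
    rw [eq_of_heq h]
    exact ⟨rfl, rfl⟩
  have := key _ _ _ _ _ _ h1 h1' h2
  exact Subtype.ext (Prod.ext this.1 this.2)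

theorem monomialSum_prod_fin {ι : Type*} (m : ι → (ℕ+ →₀ ℕ)) (n : ℕ) :
    monomialSum (fun x : ι × Fin n => m x.1) = n • monomialSum m := by
  ext α
  rw [map_nsmul, coeff_monomialSum, coeff_monomialSum]
  have e : {x : ι × Fin n // m x.1 = α} ≃ {i // m i = α} × Fin n :=
    { toFun := fun x => (⟨x.1.1, x.2⟩, x.1.2)
      invFun := fun y => ⟨(y.1.1, y.2), y.1.2⟩
      left_inv := fun x => rfl
      right_inv := fun x => rfl }
  rw [Nat.card_congr e, Nat.card_prod, Nat.card_fin]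
  simp [mul_comm]

theorem monomialSum_of_isEmpty {ι : Type*} [IsEmpty ι] (m : ι → (ℕ+ →₀ ℕ)) :
    monomialSum m = 0 := by
  ext α
  rw [coeff_monomialSum]
  simp

/-! ### Sums over colorings -/

/-- The exponent vector of the monomial of a map to the set of colors. -/
def expo {V : Type*} [Fintype V] (κ : V → ℕ+) : ℕ+ →₀ ℕ :=
  ∑ v : V, Finsupp.single (κ v) 1

theorem expo_apply {V : Type*} [Fintype V] [DecidableEq V] (κ : V → ℕ+) (c : ℕ+) :
    expo κ c = #{v | κ v = c} := by
  simp [expo, Finsupp.finsetSum_apply, Finsupp.single_apply]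

theorem expo_comp_equiv {V W : Type*} [Fintype V] [Fintype W] (e : V ≃ W) (κ : W → ℕ+) :
    expo (κ ∘ e) = expo κ :=
  Equiv.sum_comp e (fun w => Finsupp.single (κ w) 1)

theorem expo_ne_zero {V : Type*} [Fintype V] (κ : V → ℕ+) (v : V) : expo κ (κ v) ≠ 0 := by
  classical
  rw [expo_apply]
  exact (Finset.card_pos.mpr ⟨v, by simp⟩).ne'

theorem expo_sumElim {V W : Type*} [Fintype V] [Fintype W] (κ : V ⊕ W → ℕ+) :
    expo κ = expo (κ ∘ Sum.inl) + expo (κ ∘ Sum.inr) := by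
  simp [expo, Fintype.sum_sum_type]

theorem finiteFibers_expo (V : Type*) [Fintype V] : FiniteFibers (expo (V := V)) := by
  classical
  intro α
  refine Finite.of_injective (β := V → α.support)
    (fun κ v => ⟨κ.1 v, by
      have h := expo_ne_zero κ.1 v
      rwa [κ.2, ← Finsupp.mem_support_iff] at h⟩) ?_
  intro κ κ' h
  exact Subtype.ext (funext fun v => congrArg Subtype.val (congrFun h v))

/-- The generating function of the colorings satisfying `p`. -/
def colorSum {V : Type*} [Fintype V] (p : (V → ℕ+) → Prop) : MvPowerSeries ℕ+ ℤ :=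
  monomialSum (fun κ : {κ : V → ℕ+ // p κ} => expo κ.1)

/-- `κ` is a proper coloring of `G`. -/
def Proper {V : Type*} (G : SimpleGraph V) (κ : V → ℕ+) : Prop :=
  ∀ u v, G.Adj u v → κ u ≠ κ v

theorem chromaticSymmetricFunction_eq {V : Type*} [Fintype V] (G : SimpleGraph V) :
    chromaticSymmetricFunction G = colorSum (Proper G) :=
  monomialSum_congr
    (m' := fun κ : {κ : V → ℕ+ // Proper G κ} => expo κ.1)
    { toFun := fun κ => ⟨κ, fun _ _ h => κ.valid h⟩
      invFun := fun κ => SimpleGraph.Coloring.mk κ.1 fun {_ _} h => κ.2 _ _ h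
      left_inv := fun _ => rfl
      right_inv := fun _ => rfl }
    fun _ => rfl

theorem colorSum_congr {V : Type*} [Fintype V] {p q : (V → ℕ+) → Prop} (h : ∀ κ, p κ ↔ q κ) :
    colorSum p = colorSum q := by
  rw [funext fun κ => propext (h κ)]

theorem colorSum_equiv {V W : Type*} [Fintype V] [Fintype W] (e : V ≃ W)
    {p : (V → ℕ+) → Prop} {q : (W → ℕ+) → Prop} (h : ∀ κ, p (κ ∘ e) ↔ q κ) :
    colorSum p = colorSum q := by
  refine (monomialSum_congr (m' := fun κ : {κ : V → ℕ+ // p κ} => expo κ.1)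
    (((e.arrowCongr (Equiv.refl ℕ+)).symm).subtypeEquiv fun κ => ?_) fun κ => ?_).symm
  · exact (h κ).symm
  · exact expo_comp_equiv e κ.1

theorem colorSum_split {V : Type*} [Fintype V] (p r : (V → ℕ+) → Prop) :
    colorSum p = colorSum (fun κ => p κ ∧ r κ) + colorSum (fun κ => p κ ∧ ¬ r κ) := by
  unfold colorSum
  rw [monomialSum_split ((finiteFibers_expo V).subtype p) (fun κ => r κ.1)]
  congr 1
  · exact monomialSum_congr (Equiv.subtypeSubtypeEquivSubtypeInter p r) fun _ => rfl
  · exact monomialSum_congr (Equiv.subtypeSubtypeEquivSubtypeInter p (fun κ => ¬ r κ)) fun _ => rfl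

theorem colorSum_mul {V W : Type*} [Fintype V] [Fintype W] (p : (V → ℕ+) → Prop)
    (q : (W → ℕ+) → Prop) :
    colorSum p * colorSum q =
      colorSum (fun κ : V ⊕ W → ℕ+ => p (κ ∘ Sum.inl) ∧ q (κ ∘ Sum.inr)) := by
  unfold colorSum
  rw [monomialSum_mul ((finiteFibers_expo V).subtype p) ((finiteFibers_expo W).subtype q)]
  refine monomialSum_congr
    { toFun := fun x => ⟨Sum.elim x.1.1 x.2.1, x.1.2, x.2.2⟩
      invFun := fun κ => (⟨κ.1 ∘ Sum.inl, κ.2.1⟩, ⟨κ.1 ∘ Sum.inr, κ.2.2⟩)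
      left_inv := fun x => rfl
      right_inv := fun κ => Subtype.ext (Sum.elim_comp_inl_inr κ.1) } fun x => ?_
  exact expo_sumElim _

theorem colorSum_proper_of_cut {V : Type*} [Fintype V] (G : SimpleGraph V) (p : V → Prop)
    [DecidablePred p] (h : ∀ u v, p u → ¬ p v → ¬ G.Adj u v) :
    colorSum (Proper G) =
      colorSum (Proper (G.comap (Subtype.val : {v // p v} → V))) *
      colorSum (Proper (G.comap (Subtype.val : {v // ¬ p v} → V))) := by
  rw [colorSum_mul]
  refine (colorSum_equiv (Equiv.sumCompl p) fun κ => ?_).symm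
  constructor
  · rintro ⟨h1, h2⟩ u v huv
    by_cases hu : p u <;> by_cases hv : p v
    · exact h1 ⟨u, hu⟩ ⟨v, hv⟩ huv
    · exact absurd huv (h u v hu hv)
    · exact absurd huv.symm (h v u hv hu)
    · exact h2 ⟨u, hu⟩ ⟨v, hv⟩ huv
  · intro hκ
    exact ⟨fun u v huv => hκ u.1 v.1 huv, fun u v huv => hκ u.1 v.1 huv⟩

/-! ### Positivity in the elementary basis -/

theorem finiteFibers_subsetExponent (n : ℕ) :
    FiniteFibers (fun s : {s : Finset ℕ+ // #s = n} => subsetExponent s.1) :=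
  .of_injective (subsetExponent_injective.comp Subtype.val_injective)

theorem elementarySymm_zero : elementarySymm 0 = 1 := by
  classical
  ext α
  rw [elementarySymm, coeff_monomialSum, MvPowerSeries.coeff_one]
  split_ifs with h
  · subst h
    have : Unique {i : {s : Finset ℕ+ // #s = 0} // subsetExponent i.1 = 0} :=
      { default := ⟨⟨∅, rfl⟩, by simp [subsetExponent]⟩
        uniq := fun x => Subtype.ext (Subtype.ext (card_eq_zero.mp x.1.2)) }
    simp
  · have : IsEmpty {i : {s : Finset ℕ+ // #s = 0} // subsetExponent i.1 = α} :=
      ⟨fun x => h (by rw [← x.2, card_eq_zero.mp x.1.2]; simp [subsetExponent])⟩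
    simp

/-- The semiring generated by the elementary symmetric functions. -/
def ePositive : Subsemiring (MvPowerSeries ℕ+ ℤ) :=
  Subsemiring.closure (Set.range elementarySymm)

theorem elementarySymm_mem (n : ℕ) : elementarySymm n ∈ ePositive :=
  Subsemiring.subset_closure ⟨n, rfl⟩

theorem IsEPositive.add {f g : MvPowerSeries ℕ+ ℤ} (hf : IsEPositive f) (hg : IsEPositive g) :
    IsEPositive (f + g) := by
  obtain ⟨c, hc, rfl⟩ := hf
  obtain ⟨d, hd, rfl⟩ := hg
  refine ⟨c + d, fun p => add_nonneg (hc p) (hd p), ?_⟩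
  rw [Finsupp.sum_add_index'] <;> simp [add_smul]

theorem isEPositive_multiset_prod (s : Multiset ℕ) : IsEPositive (s.map elementarySymm).prod := by
  refine ⟨Finsupp.single ⟨s.sum, Nat.Partition.ofSums s.sum s rfl⟩ 1, fun p => ?_, ?_⟩
  · classical
    rw [Finsupp.single_apply]
    split_ifs <;> simp
  · rw [Finsupp.sum_single_index (by simp), one_smul, elementarySymmPart,
      Nat.Partition.ofSums_parts]
    induction s using Multiset.induction with
    | empty => simp
    | cons a s ih =>
      -- `Nat.Partition.ofSums` discards zero parts, which is harmless because `e_0 = 1`.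
      by_cases h : a = 0
      · subst h
        simpa [elementarySymm_zero] using ih
      · simp [h, ih]

theorem isEPositive_of_mem {f : MvPowerSeries ℕ+ ℤ} (hf : f ∈ ePositive) : IsEPositive f := by
  rw [ePositive, Subsemiring.mem_closure_iff] at hf
  induction hf using AddSubmonoid.closure_induction with
  | mem x hx =>
    have : ∃ s : Multiset ℕ, x = (s.map elementarySymm).prod := by
      induction hx using Submonoid.closure_induction with
      | mem x hx => obtain ⟨n, rfl⟩ := hx; exact ⟨{n}, by simp⟩
      | one => exact ⟨0, by simp⟩
      | mul x y _ _ hx hy =>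
        obtain ⟨s, rfl⟩ := hx
        obtain ⟨t, rfl⟩ := hy
        exact ⟨s + t, by simp⟩
    obtain ⟨s, rfl⟩ := this
    exact isEPositive_multiset_prod s
  | zero => exact ⟨0, by simp, by simp⟩
  | add x y _ _ hx hy => exact hx.add hy

/-! ### Paths -/

/-- Consecutive letters of the word `w` are distinct. -/
def Smirnov {n : ℕ} (w : Fin n → ℕ+) : Prop :=
  ∀ i j : Fin n, i.val + 1 = j.val → w i ≠ w j

theorem smirnov_cons {n : ℕ} (c : ℕ+) (w : Fin (n + 1) → ℕ+) :
    Smirnov (Fin.cons c w : Fin (n + 2) → ℕ+) ↔ c ≠ w 0 ∧ Smirnov w := by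
  constructor
  · intro h
    refine ⟨?_, fun i j hij => ?_⟩
    · simpa using h 0 1 rfl
    · simpa using h i.succ j.succ (by simpa using hij)
  · rintro ⟨h0, h⟩ i j hij
    induction i using Fin.cases with
    | zero =>
      obtain rfl : j = Fin.succ 0 := Fin.ext (by simpa using hij.symm)
      simpa using h0
    | succ i =>
      induction j using Fin.cases with
      | zero => simp at hij
      | succ j => simpa using h i j (by simpa using hij)

theorem expo_cons {n : ℕ} (c : ℕ+) (w : Fin n → ℕ+) :
    expo (Fin.cons c w : Fin (n + 1) → ℕ+) = Finsupp.single c 1 + expo w := by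
  simp [expo, Fin.sum_univ_succ]

/-- The chromatic symmetric function of the path on `n` vertices. -/
def pathSum (n : ℕ) : MvPowerSeries ℕ+ ℤ := colorSum (Smirnov (n := n))

/-- The pairs of a set of `i` colors and a Smirnov word of length `m`, subject to `p`. -/
def setWordSum (i m : ℕ) (p : Finset ℕ+ → (Fin m → ℕ+) → Prop) : MvPowerSeries ℕ+ ℤ :=
  monomialSum (fun x : {x : Finset ℕ+ × (Fin m → ℕ+) // (#x.1 = i ∧ Smirnov x.2) ∧ p x.1 x.2} =>
    subsetExponent x.1.1 + expo x.1.2)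

theorem finiteFibers_setWord (m : ℕ) :
    FiniteFibers (fun x : Finset ℕ+ × (Fin m → ℕ+) => subsetExponent x.1 + expo x.2) :=
  (FiniteFibers.of_injective subsetExponent_injective).prod (finiteFibers_expo (Fin m))

theorem elementarySymm_mul_pathSum (i m : ℕ) (p : Finset ℕ+ → (Fin m → ℕ+) → Prop) :
    elementarySymm i * pathSum m =
      setWordSum i m p + setWordSum i m (fun s w => ¬ p s w) := by
  have h : elementarySymm i * pathSum m =
      monomialSum (fun x : {x : Finset ℕ+ × (Fin m → ℕ+) // #x.1 = i ∧ Smirnov x.2} =>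
        subsetExponent x.1.1 + expo x.1.2) := by
    unfold elementarySymm pathSum colorSum
    rw [monomialSum_mul (finiteFibers_subsetExponent i) ((finiteFibers_expo _).subtype _)]
    exact monomialSum_congr
      { toFun := fun x => ⟨(x.1.1, x.2.1), x.1.2, x.2.2⟩
        invFun := fun x => (⟨x.1.1, x.2.1⟩, ⟨x.1.2, x.2.2⟩)
        left_inv := fun _ => rfl
        right_inv := fun _ => rfl } fun _ => rfl
  rw [h, monomialSum_split ((finiteFibers_setWord m).subtype _) (fun x => p x.1.1 x.1.2)]
  congr 1
  · exact monomialSum_congr (Equiv.subtypeSubtypeEquivSubtypeInter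
      (fun x : Finset ℕ+ × (Fin m → ℕ+) => #x.1 = i ∧ Smirnov x.2)
      (fun x => p x.1 x.2)) fun _ => rfl
  · exact monomialSum_congr (Equiv.subtypeSubtypeEquivSubtypeInter
      (fun x : Finset ℕ+ × (Fin m → ℕ+) => #x.1 = i ∧ Smirnov x.2)
      (fun x => ¬ p x.1 x.2)) fun _ => rfl

/-- Triples of a set of `i` colors, an element of it, and a Smirnov word of length `m`. -/
def MarkedSetWord (i m : ℕ) : Type :=
  {x : Finset ℕ+ × ℕ+ × (Fin m → ℕ+) // (#x.1 = i ∧ Smirnov x.2.2) ∧ x.2.1 ∈ x.1}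

theorem nsmul_elementarySymm_mul_pathSum (i m : ℕ) :
    i • (elementarySymm i * pathSum m) =
      monomialSum (fun x : MarkedSetWord i m => subsetExponent x.1.1 + expo x.1.2.2) := by
  have h : elementarySymm i * pathSum m =
      monomialSum (fun x : {s : Finset ℕ+ // #s = i} × {w : Fin m → ℕ+ // Smirnov w} =>
        subsetExponent x.1.1 + expo x.2.1) := by
    unfold elementarySymm pathSum colorSum
    rw [monomialSum_mul (finiteFibers_subsetExponent i) ((finiteFibers_expo _).subtype _)]
  -- The factor `i` becomes a choice in `Fin i`, turned into a marked element by an arbitrary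
  -- enumeration of the set.
  rw [h, ← monomialSum_prod_fin]
  refine monomialSum_congr
    { toFun := fun x => ⟨(x.1.1.1, ((x.1.1.1.equivFinOfCardEq x.1.1.2).symm x.2).1, x.1.2.1),
        ⟨x.1.1.2, x.1.2.2⟩, ((x.1.1.1.equivFinOfCardEq x.1.1.2).symm x.2).2⟩
      invFun := fun y => ((⟨y.1.1, y.2.1.1⟩, ⟨y.1.2.2, y.2.1.2⟩),
        (y.1.1.equivFinOfCardEq y.2.1.1) ⟨y.1.2.1, y.2.2⟩)
      left_inv := ?_
      right_inv := ?_ } fun _ => rfl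
  · rintro ⟨⟨⟨s, hs⟩, w⟩, k⟩
    simp
  · rintro ⟨⟨s, c, w⟩, ⟨hs, hw⟩, hc⟩
    simp
    rfl

theorem finiteFibers_markedSetWord (i m : ℕ) :
    FiniteFibers (fun x : MarkedSetWord i m => subsetExponent x.1.1 + expo x.1.2.2) := by
  intro α
  have h1 := finiteFibers_setWord m α
  refine Finite.of_injective
    (β := Σ y : {x : Finset ℕ+ × (Fin m → ℕ+) // subsetExponent x.1 + expo x.2 = α}, y.1.1)
    (fun x => ⟨⟨(x.1.1.1, x.1.1.2.2), x.2⟩, ⟨x.1.1.2.1, x.1.2.2⟩⟩) ?_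
  rintro ⟨⟨⟨s, c, w⟩, h⟩, hx⟩ ⟨⟨⟨s', c', w'⟩, h'⟩, hx'⟩ hh
  simp only [Sigma.mk.injEq, Subtype.mk.injEq, Prod.mk.injEq] at hh
  obtain ⟨⟨rfl, rfl⟩, h3⟩ := hh
  have := congrArg Subtype.val (eq_of_heq h3)
  dsimp at this
  subst this
  rfl

theorem subsetExponent_insert {c : ℕ+} {s : Finset ℕ+} (h : c ∉ s) :
    subsetExponent (insert c s) = Finsupp.single c 1 + subsetExponent s := by
  simp [subsetExponent, sum_insert h]

theorem subsetExponent_erase {c : ℕ+} {s : Finset ℕ+} (h : c ∈ s) :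
    subsetExponent s = Finsupp.single c 1 + subsetExponent (s.erase c) := by
  rw [← subsetExponent_insert (notMem_erase c s), insert_erase h]

theorem subsetExponent_erase_add_expo_cons {c : ℕ+} {s : Finset ℕ+} (h : c ∈ s) {n : ℕ}
    (w : Fin n → ℕ+) :
    subsetExponent (s.erase c) + expo (Fin.cons c w : Fin (n + 1) → ℕ+) =
      subsetExponent s + expo w := by
  rw [expo_cons, subsetExponent_erase h]
  abel

/-- Compare the marked color with the first letter. If they differ, moving the mark to the front of
the word keeps it Smirnov and leaves a set avoiding the new first letter; if they agree, the mark
carries no information beyond the first letter lying in the set. -/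
theorem succ_nsmul_elementarySymm_mul_pathSum_succ (i m : ℕ) :
    (i + 1) • (elementarySymm (i + 1) * pathSum (m + 1)) =
      setWordSum i (m + 2) (fun s w => ¬ w 0 ∈ s) +
        setWordSum (i + 1) (m + 1) (fun s w => w 0 ∈ s) := by
  rw [nsmul_elementarySymm_mul_pathSum,
    monomialSum_split (finiteFibers_markedSetWord _ _) (fun x => x.1.2.1 ≠ x.1.2.2 0)]
  congr 1
  · refine monomialSum_congr
      { toFun := fun x => ⟨(x.1.1.1.erase x.1.1.2.1, Fin.cons x.1.1.2.1 x.1.1.2.2),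
          ⟨by rw [card_erase_of_mem x.1.2.2, x.1.2.1.1]; rfl,
            (smirnov_cons _ _).mpr ⟨x.2, x.1.2.1.2⟩⟩, by simp⟩
        invFun := fun y => ⟨⟨(insert (y.1.2 0) y.1.1, y.1.2 0, Fin.tail y.1.2),
          ⟨by rw [card_insert_of_notMem y.2.2, y.2.1.1], by
            have := y.2.1.2
            rw [← Fin.cons_self_tail y.1.2] at this
            exact ((smirnov_cons _ _).mp this).2⟩, mem_insert_self _ _⟩, by
            have := y.2.1.2
            rw [← Fin.cons_self_tail y.1.2] at this
            exact ((smirnov_cons _ _).mp this).1⟩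
        left_inv := ?_
        right_inv := ?_ } fun x => ?_
    · rintro ⟨⟨⟨s, c, w⟩, ⟨hs, hw⟩, hc⟩, h⟩
      simp only [Fin.cons_zero, Fin.tail_cons, insert_erase hc]
    · rintro ⟨⟨s, w⟩, ⟨hs, hw⟩, hc⟩
      simp only [erase_insert hc, Fin.cons_self_tail]
    · exact subsetExponent_erase_add_expo_cons x.1.2.2 _
  · refine monomialSum_congr
      { toFun := fun x => ⟨(x.1.1.1, x.1.1.2.2), x.1.2.1, by
          have h := x.1.2.2
          rwa [not_not.mp x.2] at h⟩
        invFun := fun y => ⟨⟨(y.1.1, y.1.2 0, y.1.2), y.2.1, y.2.2⟩, fun h => h rfl⟩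
        left_inv := ?_
        right_inv := fun _ => rfl } fun _ => rfl
    rintro ⟨⟨⟨s, c, w⟩, ⟨hs, hw⟩, hc⟩, h⟩
    have := not_not.mp h
    dsimp at this
    subst this
    rfl

theorem succ_nsmul_elementarySymm_mul_pathSum_zero (i : ℕ) :
    (i + 1) • (elementarySymm (i + 1) * pathSum 0) =
      setWordSum i 1 (fun s w => ¬ w 0 ∈ s) := by
  rw [nsmul_elementarySymm_mul_pathSum]
  have key : ∀ w : Fin 1 → ℕ+, Smirnov w := fun w a b h => by omega
  refine monomialSum_congr
      { toFun := fun x => ⟨(x.1.1.erase x.1.2.1, fun _ => x.1.2.1),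
          ⟨by rw [card_erase_of_mem x.2.2, x.2.1.1]; rfl, key _⟩, by simp⟩
        invFun := fun y => ⟨(insert (y.1.2 0) y.1.1, y.1.2 0, Fin.elim0),
          ⟨by rw [card_insert_of_notMem y.2.2, y.2.1.1], fun a => a.elim0⟩, mem_insert_self _ _⟩
        left_inv := ?_
        right_inv := ?_ } fun x => ?_
  · rintro ⟨⟨s, c, w⟩, ⟨hs, hw⟩, hc⟩
    exact Subtype.ext (Prod.ext (insert_erase hc) (Prod.ext rfl (Subsingleton.elim _ _)))
  · rintro ⟨⟨s, w⟩, ⟨hs, hw⟩, hc⟩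
    simp only [erase_insert hc]
    refine Subtype.ext (Prod.ext rfl (funext fun k => ?_))
    rw [Subsingleton.elim k 0]
  · refine Eq.trans ?_ (subsetExponent_erase_add_expo_cons x.2.2 x.1.2.2)
    exact congrArg (_ + expo ·) (funext fun k => by rw [Subsingleton.elim k 0]; rfl)

theorem setWordSum_zero (m : ℕ) :
    setWordSum 0 (m + 1) (fun s w => w 0 ∈ s) = 0 := by
  have : IsEmpty {x : Finset ℕ+ × (Fin (m + 1) → ℕ+) //
      (#x.1 = 0 ∧ Smirnov x.2) ∧ x.2 0 ∈ x.1} :=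
    ⟨fun x => by
      have := x.2.2
      rw [card_eq_zero.mp x.2.1.1] at this
      simp at this⟩
  exact monomialSum_of_isEmpty _

theorem pathSum_zero : pathSum 0 = 1 := by
  rw [← elementarySymm_zero]
  refine monomialSum_congr
    { toFun := fun _ => ⟨∅, rfl⟩
      invFun := fun _ => ⟨Fin.elim0, fun a => a.elim0⟩
      left_inv := fun x => Subtype.ext (Subsingleton.elim _ _)
      right_inv := fun x => Subtype.ext (card_eq_zero.mp x.2).symm } fun _ => ?_
  simp [expo, subsetExponent]

/-- Both sides count pairs of a set and a nonempty Smirnov word, separated by whether the first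
letter is in the set. The pieces match after an index shift; at the boundary, an empty set contains
no letter and an empty word always accepts the mark. -/
theorem sum_nsmul_elementarySymm_mul_pathSum (n : ℕ) :
    ∑ i ∈ range (n + 1), (i + 1) • (elementarySymm (i + 1) * pathSum (n - i)) =
      ∑ i ∈ range (n + 1), elementarySymm i * pathSum (n + 1 - i) := by
  have hR : ∀ i ∈ range (n + 1), elementarySymm i * pathSum (n + 1 - i) =
      setWordSum i (n - i + 1) (fun s w => w 0 ∈ s) +
        setWordSum i (n - i + 1) (fun s w => ¬ w 0 ∈ s) := fun i hi => by
    rw [Nat.sub_add_comm (by simpa [Nat.lt_succ_iff] using hi)]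
    exact elementarySymm_mul_pathSum _ _ _
  rw [sum_congr rfl hR, sum_add_distrib, sum_range_succ, sum_range_succ' (n := n),
    Nat.sub_self, succ_nsmul_elementarySymm_mul_pathSum_zero, setWordSum_zero, add_zero,
    sum_range_succ (n := n)]
  have h0 : setWordSum n (n - n + 1) (fun s w => ¬ w 0 ∈ s) =
      setWordSum n 1 (fun s w => ¬ w 0 ∈ s) := by
    generalize hk : n - n = k
    obtain rfl : k = 0 := by omega
    rfl
  rw [h0, ← add_assoc, ← sum_add_distrib]
  congr 1
  refine sum_congr rfl fun i hi => ?_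
  obtain ⟨k, rfl⟩ := Nat.exists_eq_add_of_lt (mem_range.mp hi)
  rw [show i + k + 1 - i = k + 1 by omega, show i + k + 1 - (i + 1) = k by omega,
    succ_nsmul_elementarySymm_mul_pathSum_succ, add_comm]

/-- The recurrence for the chromatic symmetric functions of paths. -/
theorem pathSum_succ (n : ℕ) :
    pathSum (n + 1) = elementarySymm (n + 1) +
      ∑ i ∈ range (n + 1), i • (elementarySymm (i + 1) * pathSum (n - i)) := by
  have h := sum_nsmul_elementarySymm_mul_pathSum n
  -- The sum extended by `i = n + 1` is evaluated in two ways: peeling off `i = 0` isolates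
  -- `P_{n+1}`, peeling off the last term isolates `e_{n+1}`. Subtracting lowers each weight `i + 1`
  -- to `i`.
  have h' : ∑ i ∈ range (n + 2), elementarySymm i * pathSum (n + 1 - i) =
      pathSum (n + 1) + ∑ i ∈ range (n + 1), elementarySymm (i + 1) * pathSum (n - i) := by
    rw [sum_range_succ', add_comm]
    simp [elementarySymm_zero]
  rw [sum_range_succ, Nat.sub_self, pathSum_zero, mul_one, ← h] at h'
  simp only [add_smul, one_smul, sum_add_distrib] at h'
  linear_combination -h'

theorem pathSum_mem (n : ℕ) : pathSum n ∈ ePositive := by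
  induction n using Nat.strong_induction_on with
  | _ n ih =>
    cases n with
    | zero => rw [pathSum_zero]; exact one_mem _
    | succ n =>
      rw [pathSum_succ]
      exact add_mem (elementarySymm_mem _) (sum_mem fun i _ => nsmul_mem
        (mul_mem (elementarySymm_mem _) (ih _ (by omega))) i)

/-! ### Adding a vertex to a graph covered by two cliques -/

/-- The colors of multiplicity one. -/
def ones (α : ℕ+ →₀ ℕ) : Finset ℕ+ := {c ∈ α.support | α c = 1}

/-- The colors of multiplicity two. -/
def twos (α : ℕ+ →₀ ℕ) : Finset ℕ+ := {c ∈ α.support | α c = 2}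

theorem mem_ones {α : ℕ+ →₀ ℕ} {c : ℕ+} : c ∈ ones α ↔ α c = 1 := by
  simp only [ones, mem_filter, Finsupp.mem_support_iff]
  omega

theorem mem_twos {α : ℕ+ →₀ ℕ} {c : ℕ+} : c ∈ twos α ↔ α c = 2 := by
  simp only [twos, mem_filter, Finsupp.mem_support_iff]
  omega

theorem Proper.injOn {W : Type*} {G : SimpleGraph W} {κ : W → ℕ+} (hκ : Proper G κ)
    {s : Set W} (hs : G.IsClique s) : Set.InjOn κ s :=
  fun u hu v hv h => by
    by_contra hne
    exact hκ u v (hs hu hv hne) h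

section TwoCliques

variable {W : Type*} [Fintype W] [DecidableEq W] {G : SimpleGraph W} {D : Finset W} {κ : W → ℕ+}

theorem eq_of_expo_eq_one {c : ℕ+} (h : expo κ c = 1) {u v : W} (hu : κ u = c) (hv : κ v = c) :
    u = v := by
  rw [expo_apply] at h
  exact card_le_one.mp h.le u (by simpa using hu) v (by simpa using hv)

theorem Proper.exists_notMem (hκ : Proper G κ) {D : Finset W} (hD : G.IsClique (D : Set W))
    {c : ℕ+} (h : 1 < expo κ c) : ∃ u ∉ D, κ u = c := by
  rw [expo_apply, one_lt_card] at h
  obtain ⟨u, hu, v, hv, hne⟩ := h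
  by_contra! hc
  have hu' : u ∈ D := by_contra fun h => hc u h (by simpa using hu)
  have hv' : v ∈ D := by_contra fun h => hc v h (by simpa using hv)
  exact hne (hκ.injOn hD hu' hv' (by simp_all))

theorem Proper.exists_mem (hκ : Proper G κ) {D : Finset W}
    (hD : G.IsClique ((Dᶜ : Finset W) : Set W)) {c : ℕ+} (h : 1 < expo κ c) :
    ∃ u ∈ D, κ u = c := by
  obtain ⟨u, hu, h⟩ := hκ.exists_notMem hD h
  exact ⟨u, by simpa using hu, h⟩

theorem Proper.expo_le_two (hκ : Proper G κ) (hD : G.IsClique (D : Set W))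
    (hD' : G.IsClique ((Dᶜ : Finset W) : Set W)) (c : ℕ+) : expo κ c ≤ 2 := by
  rw [expo_apply, ← card_filter_add_card_filter_not (s := {v | κ v = c}) (fun v => v ∈ D)]
  have h1 : #{v ∈ ({v | κ v = c} : Finset W) | v ∈ D} ≤ 1 := card_le_one.mpr fun u hu v hv => by
    simp only [mem_filter, mem_univ, true_and] at hu hv
    exact hκ.injOn hD hu.2 hv.2 (hu.1.trans hv.1.symm)
  have h2 : #{v ∈ ({v | κ v = c} : Finset W) | v ∉ D} ≤ 1 := card_le_one.mpr fun u hu v hv => by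
    simp only [mem_filter, mem_univ, true_and] at hu hv
    exact hκ.injOn hD' (by simpa using hu.2) (by simpa using hv.2) (hu.1.trans hv.1.symm)
  omega

/-- The clique `D` shows `#D` distinct colors. A color used twice occurs once in each clique, hence
in `D`; the remaining colors of `D` are those used once and not outside it. -/
theorem Proper.card_ones_filter (hκ : Proper G κ) (hD : G.IsClique (D : Set W))
    (hD' : G.IsClique ((Dᶜ : Finset W) : Set W)) :
    #{c ∈ ones (expo κ) | ∀ u ∉ D, κ u ≠ c} + #(twos (expo κ)) = #D := by
  have hdisj : Disjoint ({c ∈ ones (expo κ) | ∀ u ∉ D, κ u ≠ c}) (twos (expo κ)) := by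
    rw [disjoint_left]
    intro c h1 h2
    rw [mem_filter, mem_ones] at h1
    rw [mem_twos] at h2
    omega
  rw [← card_union_of_disjoint hdisj, ← card_image_of_injOn (hκ.injOn hD)]
  congr 1
  ext c
  simp only [mem_union, mem_filter, mem_ones, mem_twos, mem_image]
  constructor
  · rintro (⟨h1, h2⟩ | h)
    · have : 0 < expo κ c := by omega
      rw [expo_apply, card_pos] at this
      obtain ⟨u, hu⟩ := this
      have hu : κ u = c := by simpa using hu
      exact ⟨u, by_contra fun h => h2 u h hu, hu⟩
    · exact hκ.exists_mem hD' (by omega)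
  · rintro ⟨u, hu, rfl⟩
    have h1 := expo_ne_zero κ u
    have h2 := hκ.expo_le_two hD hD' (κ u)
    by_cases h : expo κ (κ u) = 1
    · exact Or.inl ⟨h, fun v hv hvu => hv (eq_of_expo_eq_one h hvu rfl ▸ hu)⟩
    · right
      omega

end TwoCliques

/-- The coefficients of a power series, as rational numbers. -/
def coeffQ (f : MvPowerSeries ℕ+ ℤ) (α : ℕ+ →₀ ℕ) : ℚ := (MvPowerSeries.coeff α f : ℤ)

theorem coeff_colorSum {V : Type*} [Fintype V] (p : (V → ℕ+) → Prop) (α : ℕ+ →₀ ℕ) :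
    MvPowerSeries.coeff α (colorSum p) = (Nat.card {κ : V → ℕ+ // p κ ∧ expo κ = α} : ℤ) := by
  rw [colorSum, coeff_monomialSum]
  exact congrArg _ (Nat.card_congr (Equiv.subtypeSubtypeEquivSubtypeInter p (expo · = α)))

theorem coeffQ_colorSum {V : Type*} [Fintype V] (p : (V → ℕ+) → Prop) (α : ℕ+ →₀ ℕ) :
    coeffQ (colorSum p) α = Nat.card {κ : V → ℕ+ // p κ ∧ expo κ = α} := by
  rw [coeffQ, coeff_colorSum]
  simp

theorem finite_colorings {V : Type*} [Fintype V] (p : (V → ℕ+) → Prop) (α : ℕ+ →₀ ℕ) :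
    Finite {κ : V → ℕ+ // p κ ∧ expo κ = α} :=
  have := finiteFibers_expo V α
  Finite.of_injective (fun κ => (⟨κ.1, κ.2.2⟩ : {κ : V → ℕ+ // expo κ = α}))
    fun _ _ h => Subtype.ext (Subtype.mk.inj h)

/-- The effect on the coefficients of `X_G` of adding a vertex with `d` non-neighbors. -/
def addVertex (d : ℚ) (f : (ℕ+ →₀ ℕ) → ℚ) (α : ℕ+ →₀ ℕ) : ℚ :=
  open Classical in
  if ∀ c, α c ≤ 2 then
    ∑ c ∈ ones α, f (α - Finsupp.single c 1) +
      ∑ c ∈ twos α, (d - #(twos α) + 1) / (#(ones α) + 1) * f (α - Finsupp.single c 1)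
  else 0

/-- The number of proper colorings with exponent vector `β` in which `c` occurs only in `D`. -/
def restrictedCount {W : Type*} [Fintype W] (G : SimpleGraph W) (D : Finset W) (c : ℕ+)
    (β : ℕ+ →₀ ℕ) : ℕ :=
  Nat.card {κ : W → ℕ+ // (Proper G κ ∧ ∀ u ∉ D, κ u ≠ c) ∧ expo κ = β}

/-! ### Color symmetry and the coefficients after adding a vertex -/

theorem expo_perm_comp {W : Type*} [Fintype W] (σ : Equiv.Perm ℕ+) (κ : W → ℕ+) (c : ℕ+) :
    expo (σ ∘ κ) c = expo κ (σ.symm c) := by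
  classical
  simp [expo_apply, ← Equiv.eq_symm_apply]

theorem restrictedCount_eq_of_apply_eq {W : Type*} [Fintype W] (G : SimpleGraph W) (D : Finset W)
    {c c' : ℕ+} {β : ℕ+ →₀ ℕ} (h : β c = β c') :
    restrictedCount G D c β = restrictedCount G D c' β := by
  have hβ : ∀ x, β (Equiv.swap c c' x) = β x := fun x => by
    by_cases h1 : x = c
    · subst h1; rw [Equiv.swap_apply_left, h]
    · by_cases h2 : x = c'
      · subst h2; rw [Equiv.swap_apply_right, h]
      · rw [Equiv.swap_apply_of_ne_of_ne h1 h2]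
  refine Nat.card_congr (((Equiv.refl W).arrowCongr (Equiv.swap c c')).subtypeEquiv fun κ => ?_)
  have hcomp : (Equiv.refl W).arrowCongr (Equiv.swap c c') κ = Equiv.swap c c' ∘ κ := rfl
  rw [hcomp]
  refine and_congr (and_congr ?_ ?_) ?_
  · simp [Proper]
  · refine forall_congr' fun u => imp_congr_right fun _ => not_congr ?_
    rw [Function.comp_apply, Equiv.swap_apply_eq_iff, Equiv.swap_apply_right]
  · rw [Finsupp.ext_iff, Finsupp.ext_iff]
    constructor
    · intro hκ x
      rw [expo_perm_comp, Equiv.symm_swap, hκ, hβ]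
    · intro hκ x
      have := hκ (Equiv.swap c c' x)
      rwa [expo_perm_comp, Equiv.symm_swap, Equiv.swap_apply_self, hβ] at this

/-- Double count pairs of a coloring and a once-used color occurring in `D`: by symmetry each such
color contributes equally, and each coloring has `#D - #(twos β)` of them. -/
theorem card_ones_mul_restrictedCount {W : Type*} [Fintype W] {G : SimpleGraph W}
    {D : Finset W} [DecidableEq W] (hD : G.IsClique (D : Set W))
    (hD' : G.IsClique ((Dᶜ : Finset W) : Set W)) {c : ℕ+} {β : ℕ+ →₀ ℕ} (hc : β c = 1) :
    (#(ones β) * restrictedCount G D c β : ℚ) =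
      (#D - #(twos β)) * Nat.card {κ : W → ℕ+ // Proper G κ ∧ expo κ = β} := by
  classical
  have := finite_colorings (Proper G) β
  have := Fintype.ofFinite {κ : W → ℕ+ // Proper G κ ∧ expo κ = β}
  have h1 : #(ones β) * restrictedCount G D c β = ∑ c' ∈ ones β, restrictedCount G D c' β := by
    rw [← smul_eq_mul, ← sum_const]
    exact sum_congr rfl fun c' hc' =>
      restrictedCount_eq_of_apply_eq G D (hc.trans (mem_ones.mp hc').symm)
  have h2 : ∀ c', restrictedCount G D c' β =
      #{κ : {κ : W → ℕ+ // Proper G κ ∧ expo κ = β} | ∀ u ∉ D, κ.1 u ≠ c'} := fun c' => by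
    rw [← Fintype.card_subtype, ← Nat.card_eq_fintype_card]
    refine Nat.card_congr ((Equiv.subtypeEquivRight fun κ => and_right_comm).trans
      (Equiv.subtypeSubtypeEquivSubtypeInter (fun κ : W → ℕ+ => Proper G κ ∧ expo κ = β)
        (fun κ => ∀ u ∉ D, κ u ≠ c')).symm)
  simp only [h2] at h1
  have h3 := sum_card_bipartiteAbove_eq_sum_card_bipartiteBelow (s := ones β)
    (t := (univ : Finset {κ : W → ℕ+ // Proper G κ ∧ expo κ = β}))
    (fun c' κ => ∀ u ∉ D, κ.1 u ≠ c')
  simp only [bipartiteAbove, bipartiteBelow] at h3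
  rw [h3] at h1
  rw [← h2] at h1
  rw [← Nat.cast_mul, h1, Nat.cast_sum, Nat.card_eq_fintype_card, ← card_univ, mul_comm,
    ← nsmul_eq_mul, ← sum_const]
  refine sum_congr rfl fun κ _ => ?_
  have := κ.2.1.card_ones_filter hD hD'
  rw [κ.2.2] at this
  rw [← this]
  push_cast
  ring

theorem expo_option {W : Type*} [Fintype W] (κ : Option W → ℕ+) :
    expo κ = Finsupp.single (κ none) 1 + expo (κ ∘ some) := by
  simp [expo, Fintype.sum_option]

theorem single_add_eq_iff {c : ℕ+} {α β : ℕ+ →₀ ℕ} (h : α c ≠ 0) :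
    Finsupp.single c 1 + β = α ↔ β = α - Finsupp.single c 1 := by
  constructor
  · rintro rfl
    exact (add_tsub_cancel_left _ _).symm
  · rintro rfl
    refine add_tsub_cancel_of_le ?_
    rw [Finsupp.single_le_iff]
    omega

/-- Delete the new vertex, of color `c`. If `c` had multiplicity one, it is absent from the rest and
nothing is constrained. If two, its remaining occurrence must lie in `D`, and the double count gives
the proportion of colorings for which it does. -/
theorem coeffQ_option {W : Type*} [Fintype W] [DecidableEq W] (G : SimpleGraph (Option W))
    {D : Finset W} (hD : (G.comap some).IsClique (D : Set W))
    (hD' : (G.comap some).IsClique ((Dᶜ : Finset W) : Set W))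
    (hnone : ∀ u, G.Adj none (some u) ↔ u ∉ D) :
    coeffQ (colorSum (Proper G)) =
      addVertex #D (coeffQ (colorSum (Proper (G.comap some)))) := by
  classical
  ext α
  have hprop : ∀ κ : Option W → ℕ+, Proper G κ ↔
      Proper (G.comap some) (κ ∘ some) ∧ ∀ u ∉ D, (κ ∘ some) u ≠ κ none := fun κ => by
    constructor
    · intro h
      exact ⟨fun u v huv => h _ _ huv, fun u hu => (h _ _ ((hnone u).mpr hu)).symm⟩
    · rintro ⟨h1, h2⟩ u v huv
      cases u with
      | none =>
        cases v with
        | none => exact absurd huv (G.loopless.irrefl _)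
        | some v => exact (h2 v ((hnone v).mp huv)).symm
      | some u =>
        cases v with
        | none => exact h2 u ((hnone u).mp huv.symm)
        | some v => exact h1 u v huv
  rw [coeffQ_colorSum, addVertex]
  split_ifs with hα
  · have e : {κ : Option W → ℕ+ // Proper G κ ∧ expo κ = α} ≃
        Σ c : α.support, {κ : W → ℕ+ //
          (Proper (G.comap some) κ ∧ ∀ u ∉ D, κ u ≠ c) ∧ expo κ = α - Finsupp.single c.1 1} :=
      { toFun := fun κ => ⟨⟨κ.1 none, by
            have := expo_ne_zero κ.1 none
            rwa [κ.2.2, ← Finsupp.mem_support_iff] at this⟩, κ.1 ∘ some, (hprop κ.1).mp κ.2.1, by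
              have h := κ.2.2
              have h0 := expo_ne_zero κ.1 none
              rw [h] at h0
              rwa [expo_option, single_add_eq_iff h0] at h⟩
        invFun := fun x => ⟨fun o => o.elim x.1.1 x.2.1, (hprop _).mpr x.2.2.1, by
          rw [expo_option]
          exact (single_add_eq_iff (Finsupp.mem_support_iff.mp x.1.2)).mpr x.2.2.2⟩
        left_inv := fun κ => Subtype.ext (funext fun o => by cases o <;> rfl)
        right_inv := fun x => rfl }
    have := fun c : α.support => finite_colorings
      (fun κ : W → ℕ+ => Proper (G.comap some) κ ∧ ∀ u ∉ D, κ u ≠ c) (α - Finsupp.single c.1 1)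
    rw [Nat.card_congr e, Nat.card_sigma]
    change ((∑ c : α.support, restrictedCount (G.comap some) D c.1 (α - Finsupp.single c.1 1) :
      ℕ) : ℚ) = _
    rw [sum_coe_sort α.support
      (fun c => restrictedCount (G.comap some) D c (α - Finsupp.single c 1))]
    have hdisj : Disjoint (ones α) (twos α) := by
      rw [disjoint_left]
      intro c h1 h2
      rw [mem_ones] at h1
      rw [mem_twos] at h2
      omega
    have hsupp : α.support = ones α ∪ twos α := by
      ext c
      rw [mem_union, mem_ones, mem_twos, Finsupp.mem_support_iff]
      have := hα c
      omega
    rw [hsupp, sum_union hdisj]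
    push_cast
    congr 1
    · refine sum_congr rfl fun c hc => ?_
      rw [coeffQ_colorSum, restrictedCount]
      refine congrArg _ (Nat.card_congr (Equiv.subtypeEquivRight fun κ => ?_))
      rw [and_assoc]
      refine and_congr_right fun _ => and_iff_right_of_imp fun hκ u _ hu => ?_
      have h := expo_ne_zero κ u
      rw [hκ, hu] at h
      rw [mem_ones] at hc
      simp [hc] at h
    · refine sum_congr rfl fun c hc => ?_
      have hc' := mem_twos.mp hc
      have hβ : (α - Finsupp.single c 1 : ℕ+ →₀ ℕ) c = 1 := by simp [hc']
      have key := card_ones_mul_restrictedCount hD hD' hβ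
      have hones : #(ones (α - Finsupp.single c 1)) = #(ones α) + 1 := by
        rw [← card_insert_of_notMem (a := c) (by rw [mem_ones]; omega)]
        congr 1
        ext x
        rw [mem_insert, mem_ones, mem_ones, Finsupp.tsub_apply, Finsupp.single_apply]
        by_cases hx : c = x
        · subst hx; simp [hc']
        · simp [hx, Ne.symm hx]
      have htwos : #(twos (α - Finsupp.single c 1)) + 1 = #(twos α) := by
        rw [← card_erase_add_one hc]
        congr 2
        ext x
        rw [mem_erase, mem_twos, mem_twos, Finsupp.tsub_apply, Finsupp.single_apply]
        by_cases hx : c = x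
        · subst hx; simp [hc']
        · simp [hx, Ne.symm hx]
      rw [coeffQ_colorSum]
      rw [hones] at key
      rw [← htwos]
      push_cast at key ⊢
      field_simp
      linarith
  · rw [Nat.cast_eq_zero, Nat.card_eq_zero]
    left
    refine ⟨fun ⟨κ, hκ, h⟩ => hα fun c => ?_⟩
    subst h
    obtain ⟨h1, h2⟩ := (hprop κ).mp hκ
    have h3 := h1.expo_le_two hD hD' c
    rw [expo_option, Finsupp.add_apply, Finsupp.single_apply]
    split_ifs with h
    -- Two earlier uses of `c` would put one outside `D`, on a neighbor of the new vertex.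
    · by_contra hlt
      obtain ⟨u, hu, huc⟩ := h1.exists_notMem hD (c := c) (by omega)
      exact h2 u hu (huc.trans h.symm)
    · omega

theorem exists_addVertex_eq (f : (ℕ+ →₀ ℕ) → ℚ) (α : ℕ+ →₀ ℕ) :
    ∃ A B : ℚ, ∀ d, addVertex d f α = A + d * B := by
  classical
  by_cases h : ∀ c, α c ≤ 2
  · refine ⟨∑ c ∈ ones α, f (α - Finsupp.single c 1) + ∑ c ∈ twos α,
      (-(#(twos α) : ℚ) + 1) / (#(ones α) + 1) * f (α - Finsupp.single c 1),
      ∑ c ∈ twos α, 1 / (#(ones α) + 1 : ℚ) * f (α - Finsupp.single c 1), fun d => ?_⟩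
    rw [addVertex, if_pos h, add_assoc, mul_sum, ← sum_add_distrib]
    congr 1
    refine sum_congr rfl fun c _ => ?_
    ring
  · exact ⟨0, 0, fun d => by rw [addVertex, if_neg h]; ring⟩

theorem addVertex_sum {ι : Type*} (s : Finset ι) (q : ι → ℚ) (f : ι → (ℕ+ →₀ ℕ) → ℚ) (d : ℚ)
    (α : ℕ+ →₀ ℕ) :
    addVertex d (fun β => ∑ i ∈ s, q i * f i β) α = ∑ i ∈ s, q i * addVertex d (f i) α := by
  classical
  unfold addVertex
  split_ifs
  · simp only [mul_add, sum_add_distrib, mul_sum]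
    rw [sum_comm (s := s), sum_comm (s := s)]
    congr 1
    refine sum_congr rfl fun c _ => sum_congr rfl fun i _ => ?_
    ring
  · simp

theorem addVertex_mul (q : ℚ) (f : (ℕ+ →₀ ℕ) → ℚ) (d : ℚ) (α : ℕ+ →₀ ℕ) :
    addVertex d (fun β => q * f β) α = q * addVertex d f α := by
  simpa using addVertex_sum (Finset.univ : Finset Unit) (fun _ => q) (fun _ => f) d α

/-! ### Disjoint unions of two cliques -/

theorem colorSum_proper_top (V : Type*) [Fintype V] :
    colorSum (Proper (⊤ : SimpleGraph V)) =
      (Fintype.card V).factorial • elementarySymm (Fintype.card V) := by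
  classical
  rw [elementarySymm, ← monomialSum_prod_fin]
  -- A coloring of a clique is a color set with a bijection onto it; `e1` numbers the bijections
  -- arbitrarily.
  have e1 : ∀ s : {s : Finset ℕ+ // #s = Fintype.card V},
      Fin (Fintype.card V).factorial ≃ (V ≃ s.1) := fun s =>
    (Fintype.equivFinOfCardEq (Fintype.card_equiv
      (Fintype.equivOfCardEq (by simp [s.2])))).symm
  have hexpo : ∀ (s : Finset ℕ+) (e : V ≃ s), expo (fun v => (e v).1) = subsetExponent s :=
    fun s e => by
      rw [expo, subsetExponent, Equiv.sum_comp e (fun c : s => Finsupp.single c.1 1),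
        sum_coe_sort s (fun c => Finsupp.single c 1)]
  symm
  refine monomialSum_congr (Equiv.ofBijective (fun x => ⟨fun v => (e1 x.1 x.2 v).1,
    fun u v huv h => huv ((e1 x.1 x.2).injective (Subtype.ext h))⟩) ⟨?_, ?_⟩) fun x => ?_
  · rintro ⟨s, k⟩ ⟨t, l⟩ h
    have h' := Subtype.mk.inj h
    have hst : s = t := by
      apply Subtype.ext
      apply subsetExponent_injective
      rw [← hexpo s.1 (e1 s k), ← hexpo t.1 (e1 t l)]
      exact congrArg expo h'
    subst hst
    have : e1 s k = e1 s l := Equiv.ext fun v => Subtype.ext (congrFun h' v)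
    rw [(e1 s).injective this]
  · rintro ⟨κ, hκ⟩
    have hinj : Function.Injective κ := fun u v h => by
      by_contra hne
      exact hκ u v hne h
    have hcard : #(univ.image κ) = Fintype.card V := by
      rw [card_image_of_injective _ hinj, card_univ]
    let e : V ≃ ((univ.image κ : Finset ℕ+) : Type) := Equiv.ofBijective
      (fun v => ⟨κ v, mem_image_of_mem κ (mem_univ v)⟩)
      ⟨fun u v h => hinj (congrArg Subtype.val h), fun ⟨c, hc⟩ => by
        obtain ⟨v, -, rfl⟩ := mem_image.mp hc
        exact ⟨v, rfl⟩⟩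
    refine ⟨(⟨univ.image κ, hcard⟩, (e1 ⟨univ.image κ, hcard⟩).symm e), Subtype.ext ?_⟩
    funext v
    dsimp only
    rw [Equiv.apply_symm_apply]
    rfl
  · exact hexpo _ _

/-- The disjoint union of the complete graphs on the two fibers of `s`. -/
def twoCliques {V : Type*} (s : V → Bool) : SimpleGraph V where
  Adj u v := u ≠ v ∧ s u = s v
  symm := ⟨fun _ _ h => ⟨h.1.symm, h.2.symm⟩⟩
  loopless := ⟨fun _ h => h.1 rfl⟩

theorem colorSum_twoCliques {V : Type*} [Fintype V] (s : V → Bool) (a b : ℕ)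
    (ha : Fintype.card {v // s v = true} = a) (hb : Fintype.card {v // ¬ s v = true} = b) :
    colorSum (Proper (twoCliques s)) =
      (a.factorial * b.factorial) • (elementarySymm a * elementarySymm b) := by
  rw [colorSum_proper_of_cut (twoCliques s) (fun v => s v = true)
    (fun u v hu hv h => hv (h.2.symm.trans hu))]
  have h1 : (twoCliques s).comap (Subtype.val : {v // s v = true} → V) = ⊤ := by
    ext u v
    simp only [SimpleGraph.comap_adj, SimpleGraph.top_adj, twoCliques]
    exact ⟨fun h e => h.1 (congrArg _ e), fun h => ⟨fun e => h (Subtype.ext e),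
      u.2.trans v.2.symm⟩⟩
  have h2 : (twoCliques s).comap (Subtype.val : {v // ¬ s v = true} → V) = ⊤ := by
    ext u v
    simp only [SimpleGraph.comap_adj, SimpleGraph.top_adj, twoCliques]
    refine ⟨fun h e => h.1 (congrArg _ e), fun h => ⟨fun e => h (Subtype.ext e), ?_⟩⟩
    exact (Bool.eq_false_iff.mpr u.2).trans (Bool.eq_false_iff.mpr v.2).symm
  rw [h1, h2, colorSum_proper_top, colorSum_proper_top, ha, hb]
  simp only [nsmul_eq_mul]
  push_cast
  ring

/-- The coefficients of `e_j e_m`. -/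
def elemPair (j m : ℕ) : (ℕ+ →₀ ℕ) → ℚ := coeffQ (elementarySymm j * elementarySymm m)

theorem elemPair_comm (j m : ℕ) : elemPair j m = elemPair m j := by
  rw [elemPair, mul_comm, elemPair]

theorem coeffQ_nsmul (n : ℕ) (f : MvPowerSeries ℕ+ ℤ) (α : ℕ+ →₀ ℕ) :
    coeffQ (n • f) α = n * coeffQ f α := by
  rw [coeffQ, map_nsmul, coeffQ]
  simp

/-- Add a vertex to `K_j ⊔ K_m`, joined to all of `K_j`, to get `K_{j+1} ⊔ K_m`. Both chromatic
functions are known; cancel the factorials. -/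
theorem addVertex_elemPair_right (j m : ℕ) (α : ℕ+ →₀ ℕ) :
    addVertex m (elemPair j m) α = (j + 1) * elemPair (j + 1) m α := by
  let s : Option (Fin j ⊕ Fin m) → Bool := fun o => o.elim true Sum.isLeft
  let D : Finset (Fin j ⊕ Fin m) := {u | ¬ u.isLeft = true}
  have hcomap : (twoCliques s).comap some = twoCliques (Sum.isLeft : Fin j ⊕ Fin m → Bool) := by
    ext u v
    simp [twoCliques, s]
  have hcard : #D = m := by
    simp only [D, card_filter, Fintype.sum_sum_type]
    simp
  have h := congrFun (coeffQ_option (twoCliques s) (D := D)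
    (fun u hu v hv hne => by
      simp only [D, coe_filter, Set.mem_ofPred_eq, mem_univ, true_and, Bool.not_eq_true] at hu hv
      rw [hcomap]
      exact ⟨hne, hu.trans hv.symm⟩)
    (fun u hu v hv hne => by
      simp only [D, coe_compl, coe_filter, Set.mem_compl_iff, Set.mem_ofPred_eq, mem_univ,
        true_and, not_not] at hu hv
      rw [hcomap]
      exact ⟨hne, hu.trans hv.symm⟩)
    (fun u => by
      simp only [D, mem_filter, mem_univ, true_and, not_not]
      exact ⟨fun h => h.2.symm, fun h => ⟨Option.some_ne_none u |>.symm, h.symm⟩⟩)) α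
  rw [hcomap, hcard,
    colorSum_twoCliques s (j + 1) m
      (by
        rw [Fintype.card_subtype]
        simp only [card_filter, Fintype.sum_option, Fintype.sum_sum_type, s]
        simp [add_comm])
      (by
        rw [Fintype.card_subtype]
        simp only [card_filter, Fintype.sum_option, Fintype.sum_sum_type, s]
        simp),
    colorSum_twoCliques _ j m
      (by
        rw [Fintype.card_subtype]
        simp only [card_filter, Fintype.sum_sum_type]
        simp)
      (by
        rw [Fintype.card_subtype]
        simp only [card_filter, Fintype.sum_sum_type]
        simp), coeffQ_nsmul] at h
  have h' : coeffQ ((j.factorial * m.factorial) • (elementarySymm j * elementarySymm m)) =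
      fun β => ((j.factorial * m.factorial : ℕ) : ℚ) * elemPair j m β :=
    funext fun β => coeffQ_nsmul _ _ _
  rw [h', addVertex_mul, Nat.factorial_succ] at h
  have hj : (j.factorial : ℚ) ≠ 0 := by exact_mod_cast j.factorial_ne_zero
  have hm : (m.factorial : ℚ) ≠ 0 := by exact_mod_cast m.factorial_ne_zero
  push_cast at h
  refine mul_left_cancel₀ (mul_ne_zero hj hm) ?_
  rw [← h, elemPair]
  ring

theorem addVertex_elemPair_left (j m : ℕ) (α : ℕ+ →₀ ℕ) :
    addVertex j (elemPair j m) α = (m + 1) * elemPair j (m + 1) α := by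
  rw [elemPair_comm, addVertex_elemPair_right, elemPair_comm]

/-- Affine interpolation in `d` between `d = j` and `d = m`, multiplied through by `m - j` so that
`j = m` is allowed. -/
theorem addVertex_elemPair (d : ℚ) (j m : ℕ) (α : ℕ+ →₀ ℕ) :
    (m - j) * addVertex d (elemPair j m) α =
      (d - j) * ((j + 1) * elemPair (j + 1) m α) + (m - d) * ((m + 1) * elemPair j (m + 1) α) := by
  obtain ⟨A, B, h⟩ := exists_addVertex_eq (elemPair j m) α
  rw [← addVertex_elemPair_right, ← addVertex_elemPair_left, h, h, h]
  ring

/-! ### Triangularity of the products `e_j e_m` -/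

theorem subsetExponent_apply (s : Finset ℕ+) (c : ℕ+) :
    subsetExponent s c = if c ∈ s then 1 else 0 := by
  classical
  simp [subsetExponent, Finsupp.finsetSum_apply, Finsupp.single_apply]

theorem elemPair_eq_card (i k : ℕ) (α : ℕ+ →₀ ℕ) :
    elemPair i k α = Nat.card {x : {s : Finset ℕ+ // #s = i} × {s : Finset ℕ+ // #s = k} //
      subsetExponent x.1.1 + subsetExponent x.2.1 = α} := by
  rw [elemPair, coeffQ, elementarySymm, elementarySymm,
    monomialSum_mul (finiteFibers_subsetExponent i) (finiteFibers_subsetExponent k),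
    coeff_monomialSum]
  simp

/-- A color of `A` has multiplicity two, and each of `S`, `T` supplies at most one. -/
theorem subset_of_subsetExponent_add {A B S T : Finset ℕ+} (hAB : A ⊆ B)
    (h : subsetExponent S + subsetExponent T = subsetExponent A + subsetExponent B) : A ⊆ S := by
  intro c hc
  by_contra hS
  have := DFunLike.congr_fun h c
  simp only [Finsupp.add_apply, subsetExponent_apply, hS, hc, hAB hc, if_true, if_false] at this
  split_ifs at this <;> omega

theorem elemPair_eq_zero {A B : Finset ℕ+} (hAB : A ⊆ B) {i : ℕ} (hi : i < #A) (k : ℕ) :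
    elemPair i k (subsetExponent A + subsetExponent B) = 0 := by
  rw [elemPair_eq_card, Nat.cast_eq_zero, Nat.card_eq_zero]
  left
  refine ⟨fun ⟨⟨S, T⟩, h⟩ => ?_⟩
  have := card_le_card (subset_of_subsetExponent_add hAB h)
  have hS := S.2
  dsimp only at this
  omega

theorem elemPair_eq_one {A B : Finset ℕ+} (hAB : A ⊆ B) :
    elemPair #A #B (subsetExponent A + subsetExponent B) = 1 := by
  rw [elemPair_eq_card, Nat.cast_eq_one, Nat.card_eq_one_iff_unique]
  refine ⟨⟨?_⟩, ⟨⟨(⟨A, rfl⟩, ⟨B, rfl⟩), rfl⟩⟩⟩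
  have key : ∀ x : {x : {s : Finset ℕ+ // #s = #A} × {s : Finset ℕ+ // #s = #B} //
      subsetExponent x.1.1 + subsetExponent x.2.1 = subsetExponent A + subsetExponent B},
      x.1 = (⟨A, rfl⟩, ⟨B, rfl⟩) := by
    rintro ⟨⟨⟨S, hS⟩, ⟨T, hT⟩⟩, h⟩
    dsimp only at h
    have hAS := eq_of_subset_of_card_le (subset_of_subsetExponent_add hAB h) hS.le
    subst hAS
    have := subsetExponent_injective (add_left_cancel h)
    subst this
    rfl
  exact fun x y => Subtype.ext ((key x).trans (key y).symm)

/-! ### The cone spanned by the products of two elementary symmetric functions -/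

/-- `f` is a nonnegative combination of the coefficient functions of `e_j e_{n-j}`. -/
def InCone (n : ℕ) (f : (ℕ+ →₀ ℕ) → ℚ) : Prop :=
  ∃ q : ℕ → ℚ, (∀ j, 0 ≤ q j) ∧
    ∀ α, f α = ∑ j ∈ range (n / 2 + 1), q j * elemPair j (n - j) α

theorem inCone_zero (n : ℕ) : InCone n (fun _ => 0) := ⟨fun _ => 0, by simp, by simp⟩

theorem InCone.add {n : ℕ} {f g : (ℕ+ →₀ ℕ) → ℚ} (hf : InCone n f) (hg : InCone n g) :
    InCone n (fun α => f α + g α) := by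
  obtain ⟨q, hq, hf⟩ := hf
  obtain ⟨r, hr, hg⟩ := hg
  refine ⟨fun j => q j + r j, fun j => add_nonneg (hq j) (hr j), fun α => ?_⟩
  simp only [hf, hg]
  rw [← sum_add_distrib]
  simp only [add_mul]

theorem InCone.mul {n : ℕ} {f : (ℕ+ →₀ ℕ) → ℚ} (hf : InCone n f) {a : ℚ} (ha : 0 ≤ a) :
    InCone n (fun α => a * f α) := by
  obtain ⟨q, hq, hf⟩ := hf
  refine ⟨fun j => a * q j, fun j => mul_nonneg ha (hq j), fun α => ?_⟩
  simp only [hf, mul_sum, mul_assoc]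

theorem InCone.sum {n : ℕ} {ι : Type*} (s : Finset ι) {f : ι → (ℕ+ →₀ ℕ) → ℚ}
    (hf : ∀ i ∈ s, InCone n (f i)) : InCone n (fun α => ∑ i ∈ s, f i α) := by
  classical
  induction s using Finset.induction_on with
  | empty => simpa using inCone_zero n
  | insert a s ha ih =>
    simp only [sum_insert ha]
    exact (hf a (mem_insert_self _ _)).add (ih fun i hi => hf i (mem_insert_of_mem hi))

theorem inCone_elemPair {j m : ℕ} (h : j ≤ m) : InCone (j + m) (elemPair j m) := by
  refine ⟨fun i => if i = j then 1 else 0, fun i => by positivity, fun α => ?_⟩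
  simp only [ite_mul, one_mul, zero_mul, sum_ite_eq', mem_range]
  rw [if_pos (by omega), Nat.add_sub_cancel_left]

theorem inCone_addVertex_elemPair {d j m : ℕ} (hj : j ≤ d) (hm : d ≤ m) :
    InCone (j + m + 1) (addVertex d (elemPair j m)) := by
  rcases (hj.trans hm).eq_or_lt with h | h
  · obtain rfl : d = j := by omega
    rw [funext (addVertex_elemPair_left d m)]
    exact (inCone_elemPair (j := d) (m := m + 1) (by omega)).mul (by positivity)
  · have hpos : (0 : ℚ) < m - j := by
      rw [sub_pos]
      exact_mod_cast h
    have hj' : (0 : ℚ) ≤ d - j := by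
      rw [sub_nonneg]
      exact_mod_cast hj
    have hm' : (0 : ℚ) ≤ m - d := by
      rw [sub_nonneg]
      exact_mod_cast hm
    have : addVertex d (elemPair j m) = fun α =>
        (d - j : ℚ) / (m - j) * (j + 1) * elemPair (j + 1) m α +
          (m - d : ℚ) / (m - j) * (m + 1) * elemPair j (m + 1) α := by
      ext α
      rw [← mul_right_inj' hpos.ne', addVertex_elemPair]
      field_simp
    rw [this]
    refine InCone.add (InCone.mul ?_ (by positivity)) (InCone.mul ?_ (by positivity))
    · have := inCone_elemPair (j := j + 1) (m := m) h
      rwa [add_right_comm] at this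
    · exact inCone_elemPair (j := j) (m := m + 1) (by omega)

theorem exists_subset_card {j m : ℕ} (h : j ≤ m) :
    ∃ A B : Finset ℕ+, A ⊆ B ∧ #A = j ∧ #B = m := by
  obtain ⟨B, hB⟩ := Infinite.exists_subset_card_eq ℕ+ m
  obtain ⟨A, hA, hA'⟩ := exists_subset_card_eq (s := B) (n := j) (by omega)
  exact ⟨A, B, hA, hA', hB⟩

theorem elemPair_nonneg (i k : ℕ) (α : ℕ+ →₀ ℕ) : 0 ≤ elemPair i k α := by
  rw [elemPair_eq_card]
  positivity

/-- If `q j > 0`, some coloring has monomial `x_A x_B` with `A ⊆ B`, `#A = j`, `#B = n - j`. Each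
color of `A` is used twice, hence in `D`, while `D` uses distinct colors, all in `B`. So `j ≤ #D ≤ n
- j`, as interpolation requires. -/
theorem inCone_option {W : Type*} [Fintype W] [DecidableEq W] (G : SimpleGraph (Option W))
    {D : Finset W} (hD : (G.comap some).IsClique (D : Set W))
    (hD' : (G.comap some).IsClique ((Dᶜ : Finset W) : Set W))
    (hnone : ∀ u, G.Adj none (some u) ↔ u ∉ D) {n : ℕ}
    (h : InCone n (coeffQ (colorSum (Proper (G.comap some))))) :
    InCone (n + 1) (coeffQ (colorSum (Proper G))) := by
  rw [coeffQ_option G hD hD' hnone]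
  obtain ⟨q, hq, hf⟩ := h
  rw [funext hf, funext (addVertex_sum _ q (fun j => elemPair j (n - j)) _)]
  refine InCone.sum _ fun j hj => ?_
  rw [mem_range] at hj
  rcases (hq j).eq_or_lt with h0 | hpos
  · simpa [← h0] using inCone_zero (n + 1)
  refine InCone.mul ?_ (hq j)
  obtain ⟨A, B, hAB, rfl, hB⟩ := exists_subset_card (j := j) (m := n - j) (by omega)
  have hpos' : 0 < coeffQ (colorSum (Proper (G.comap some)))
      (subsetExponent A + subsetExponent B) := by
    rw [hf]
    refine lt_of_lt_of_le ?_ (single_le_sum (fun i _ => mul_nonneg (hq i) (elemPair_nonneg _ _ _))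
      (mem_range.mpr hj))
    rw [← hB, elemPair_eq_one hAB, mul_one]
    exact hpos
  rw [coeffQ_colorSum, Nat.cast_pos, Nat.card_pos_iff] at hpos'
  obtain ⟨⟨κ, hκ, hexp⟩⟩ := hpos'.1
  have h1 : #A ≤ #D := by
    refine (card_le_card (t := D.image κ) fun c hc => ?_).trans card_image_le
    have : expo κ c = 2 := by
      rw [hexp]
      simp [subsetExponent_apply, hc, hAB hc]
    obtain ⟨u, hu, huc⟩ := hκ.exists_mem hD' (c := c) (by omega)
    exact mem_image.mpr ⟨u, hu, huc⟩
  have h2 : #D ≤ n - #A := by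
    rw [← hB, ← card_image_of_injOn (hκ.injOn hD)]
    refine card_le_card fun c hc => ?_
    obtain ⟨u, -, rfl⟩ := mem_image.mp hc
    have := expo_ne_zero κ u
    rw [hexp, Finsupp.add_apply, subsetExponent_apply, subsetExponent_apply] at this
    by_contra hB'
    have hA' : κ u ∉ A := fun h => hB' (hAB h)
    simp [hA', hB'] at this
  have := inCone_addVertex_elemPair h1 h2
  rwa [Nat.add_sub_cancel' (by omega)] at this

/-- Descending induction on `j` from `n / 2`: the coefficient at `x_A x_B` with `#A = j` sees no
product of smaller index and sees `e_j e_{n-j}` once, so `q j` is an integer minus integers already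
found. -/
theorem exists_nat_of_inCone {n : ℕ} {f : MvPowerSeries ℕ+ ℤ} {q : ℕ → ℚ} (hq : ∀ j, 0 ≤ q j)
    (hf : ∀ α, coeffQ f α = ∑ j ∈ range (n / 2 + 1), q j * elemPair j (n - j) α) :
    ∀ k j, j + k = n / 2 → ∃ z : ℕ, q j = z := by
  intro k
  induction k using Nat.strong_induction_on with
  | _ k ih =>
    intro j hjk
    obtain ⟨A, B, hAB, hA, hB⟩ := exists_subset_card (j := j) (m := n - j) (by omega)
    have h := hf (subsetExponent A + subsetExponent B)
    rw [show n / 2 + 1 = j + (k + 1) by omega, sum_range_add, sum_range_succ'] at h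
    rw [sum_eq_zero (fun i hi => by
      rw [elemPair_eq_zero hAB (by rw [hA]; exact mem_range.mp hi), mul_zero])] at h
    have h1 : elemPair j (n - j) (subsetExponent A + subsetExponent B) = 1 := by
      rw [← hB, ← hA, elemPair_eq_one hAB]
    rw [add_zero, h1, mul_one, zero_add] at h
    choose! z hz using fun i (hi : i ∈ range k) =>
      ih (k - (i + 1)) (by have := mem_range.mp hi; omega) (j + (i + 1))
        (by have := mem_range.mp hi; omega)
    have hq' : q j = ((MvPowerSeries.coeff (subsetExponent A + subsetExponent B) f -
        ∑ i ∈ range k, z i * MvPowerSeries.coeff (subsetExponent A + subsetExponent B)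
          (elementarySymm (j + (i + 1)) * elementarySymm (n - (j + (i + 1)))) : ℤ) : ℚ) := by
      push_cast
      rw [eq_sub_iff_add_eq', ← coeffQ, h]
      congr 1
      refine sum_congr rfl fun i hi => ?_
      rw [hz i hi]
      rfl
    have h0 := hq j
    rw [hq'] at h0 ⊢
    obtain ⟨z, hz⟩ := Int.eq_ofNat_of_zero_le (by exact_mod_cast h0)
    exact ⟨z, by rw [hz]; rfl⟩

theorem mem_ePositive_of_inCone {n : ℕ} {f : MvPowerSeries ℕ+ ℤ} (h : InCone n (coeffQ f)) :
    f ∈ ePositive := by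
  obtain ⟨q, hq, hf⟩ := h
  choose! z hz using fun j (hj : j ∈ range (n / 2 + 1)) =>
    exists_nat_of_inCone hq hf (n / 2 - j) j (by have := mem_range.mp hj; omega)
  have : f = ∑ j ∈ range (n / 2 + 1), z j • (elementarySymm j * elementarySymm (n - j)) := by
    ext α
    have h := hf α
    rw [sum_congr rfl fun j hj => by rw [hz j hj, elemPair, ← coeffQ_nsmul]] at h
    unfold coeffQ at h
    rw [map_sum]
    exact_mod_cast h
  rw [this]
  exact sum_mem fun j _ => nsmul_mem (mul_mem (elementarySymm_mem _) (elementarySymm_mem _)) _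

/-! ### Unit interval graphs without stable triples -/

/-- `a` is a representation of `G` by the unit intervals with left endpoints `a v`. -/
def IsUnitRep {V : Type*} (G : SimpleGraph V) (a : V → ℝ) : Prop :=
  ∀ u v, G.Adj u v ↔ u ≠ v ∧ |a u - a v| ≤ 1

theorem IsUnitRep.comap {V W : Type*} {G : SimpleGraph V} {a : V → ℝ} (h : IsUnitRep G a)
    {f : W → V} (hf : Function.Injective f) : IsUnitRep (G.comap f) (a ∘ f) := fun u v => by
  rw [SimpleGraph.comap_adj, h, hf.ne_iff]
  rfl

theorem colorSum_proper_comap {V W : Type*} [Fintype V] [Fintype W] (G : SimpleGraph V)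
    (e : W ≃ V) : colorSum (Proper (G.comap e)) = colorSum (Proper G) := by
  refine colorSum_equiv e fun κ => ⟨fun h u v huv => ?_, fun h u v huv => h _ _ huv⟩
  have := h (e.symm u) (e.symm v) (by simpa using huv)
  simpa using this

/-- Remove the leftmost vertex. Its neighbors' left endpoints lie within one unit to its right, so
they form a clique; its non-neighbors do because there is no stable triple. -/
theorem inCone_of_isUnitRep {n : ℕ} : ∀ {V : Type*} [Fintype V] (G : SimpleGraph V) (a : V → ℝ),
    Fintype.card V = n → IsUnitRep G a →
    (∀ u v w, u ≠ v → u ≠ w → v ≠ w → G.Adj u v ∨ G.Adj u w ∨ G.Adj v w) →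
    InCone n (coeffQ (colorSum (Proper G))) := by
  classical
  induction n with
  | zero =>
    intro V _ G a hV ha hst
    have hV' : IsEmpty V := Fintype.card_eq_zero_iff.mp hV
    have hG : G = ⊤ := by
      ext u
      exact hV'.elim u
    rw [hG, colorSum_proper_top, hV]
    have := inCone_elemPair (le_refl 0)
    rw [elemPair, elementarySymm_zero, mul_one] at this
    simpa [elementarySymm_zero] using this
  | succ n ih =>
    intro V _ G a hV ha hst
    have hne : Nonempty V := Fintype.card_pos_iff.mp (by omega)
    obtain ⟨w, hw⟩ := Finite.exists_min a
    rw [← colorSum_proper_comap G (Equiv.optionSubtypeNe w)]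
    have hcomap : (G.comap (Equiv.optionSubtypeNe w)).comap some =
        G.comap (Subtype.val : {v // v ≠ w} → V) := by
      ext u v
      simp
    refine inCone_option (D := {u : {v // v ≠ w} | ¬ G.Adj w u.1}) _ ?_ ?_ ?_ ?_
    · intro u hu v hv huv
      simp only [coe_filter, Set.mem_ofPred_eq, mem_univ, true_and] at hu hv
      rw [hcomap]
      rcases hst w u.1 v.1 u.2.symm v.2.symm (fun h => huv (Subtype.ext h)) with h | h | h
      · exact absurd h hu
      · exact absurd h hv
      · exact h
    · intro u hu v hv huv
      simp only [coe_compl, coe_filter, Set.mem_compl_iff, Set.mem_ofPred_eq, mem_univ, true_and,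
        not_not] at hu hv
      rw [hcomap]
      have h1 := ((ha _ _).mp hu).2
      have h2 := ((ha _ _).mp hv).2
      refine (ha _ _).mpr ⟨fun h => huv (Subtype.ext h), ?_⟩
      have := hw u.1
      have := hw v.1
      rw [abs_le] at h1 h2 ⊢
      constructor <;> linarith
    · intro u
      simp
    · rw [hcomap]
      refine ih _ (a ∘ Subtype.val) ?_ (ha.comap Subtype.val_injective) ?_
      · rw [Fintype.card_subtype_compl, hV, Fintype.card_subtype_eq, Nat.add_sub_cancel]
      · intro u v x huv hux hvx
        exact hst _ _ _ (fun h => huv (Subtype.ext h)) (fun h => hux (Subtype.ext h))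
          (fun h => hvx (Subtype.ext h))

/-! ### The bull -/

/-- `κ` is a proper coloring of the bull: the path `0, 1, 2, 3, 4` with the chord `1, 3`. -/
def BullProper (κ : Fin 5 → ℕ+) : Prop :=
  κ 0 ≠ κ 1 ∧ κ 1 ≠ κ 2 ∧ κ 2 ≠ κ 3 ∧ κ 3 ≠ κ 4 ∧ κ 1 ≠ κ 3

theorem smirnov_iff {n : ℕ} (w : Fin (n + 1) → ℕ+) :
    Smirnov w ↔ ∀ i : Fin n, w i.castSucc ≠ w i.succ := by
  refine ⟨fun h i => h _ _ (by simp), fun h i j hij => ?_⟩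
  have := h ⟨i.val, by omega⟩
  rwa [show j = Fin.succ ⟨i.val, by omega⟩ from Fin.ext hij.symm]

theorem pathSum_five_eq_add :
    pathSum 5 = colorSum (fun κ : Fin 5 → ℕ+ =>
      (κ 0 ≠ κ 1 ∧ κ 1 ≠ κ 2 ∧ κ 2 ≠ κ 3 ∧ κ 3 ≠ κ 4) ∧ κ 1 = κ 3) + colorSum BullProper := by
  have h : pathSum 5 = colorSum (fun κ : Fin 5 → ℕ+ =>
      κ 0 ≠ κ 1 ∧ κ 1 ≠ κ 2 ∧ κ 2 ≠ κ 3 ∧ κ 3 ≠ κ 4) := colorSum_congr fun κ => by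
    rw [smirnov_iff]
    simp [Fin.forall_fin_succ]
  rw [h, colorSum_split _ (fun κ => κ 1 = κ 3)]
  congr 1
  exact colorSum_congr fun κ => by simp only [BullProper]; tauto

theorem pathSum_two_mul_pathSum_three_eq_add :
    pathSum 2 * pathSum 3 =
      colorSum (fun κ : Fin 5 → ℕ+ => (κ 0 ≠ κ 1 ∧ κ 1 ≠ κ 3 ∧ κ 3 ≠ κ 4) ∧ κ 2 = κ 1) +
      (colorSum (fun κ : Fin 5 → ℕ+ =>
        (κ 0 ≠ κ 1 ∧ κ 1 ≠ κ 2 ∧ κ 2 ≠ κ 3 ∧ κ 3 ≠ κ 4) ∧ κ 1 = κ 3) + colorSum BullProper) := by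
  have h : pathSum 2 * pathSum 3 = colorSum (fun κ : Fin 5 → ℕ+ =>
      κ 0 ≠ κ 1 ∧ κ 2 ≠ κ 3 ∧ κ 3 ≠ κ 4) := by
    rw [pathSum, pathSum, colorSum_mul]
    refine colorSum_equiv finSumFinEquiv fun κ => ?_
    rw [smirnov_iff, smirnov_iff]
    simp only [Fin.forall_fin_succ, IsEmpty.forall_iff, and_true]
    exact Iff.rfl
  rw [h, colorSum_split _ (fun κ => κ 2 = κ 1),
    colorSum_split (fun κ : Fin 5 → ℕ+ => _ ∧ ¬ κ 2 = κ 1) (fun κ => κ 1 = κ 3)]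
  congr 1
  · refine colorSum_congr fun κ => ?_
    constructor <;> rintro ⟨⟨h1, h2, h3⟩, h4⟩ <;> simp_all
  · congr 1 <;> refine colorSum_congr fun κ => ?_
    · constructor
      · rintro ⟨⟨⟨h1, h2, h3⟩, h4⟩, h5⟩
        exact ⟨⟨h1, Ne.symm h4, h2, h3⟩, h5⟩
      · rintro ⟨⟨h1, h2, h3, h4⟩, h5⟩
        exact ⟨⟨⟨h1, h3, h4⟩, Ne.symm h2⟩, h5⟩
    · constructor
      · rintro ⟨⟨⟨h1, h2, h3⟩, h4⟩, h5⟩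
        exact ⟨h1, Ne.symm h4, h2, h3, h5⟩
      · rintro ⟨h1, h2, h3, h4, h5⟩
        exact ⟨⟨⟨h1, h3, h4⟩, Ne.symm h2⟩, h5⟩

theorem pathSum_four_mul_pathSum_one_eq_add :
    pathSum 4 * pathSum 1 =
      2 * colorSum (fun κ : Fin 5 → ℕ+ => (κ 0 ≠ κ 1 ∧ κ 1 ≠ κ 3 ∧ κ 3 ≠ κ 4) ∧ κ 2 = κ 1) +
        colorSum BullProper := by
  -- Places the four-vertex path on `0, 1, 3, 4` and the isolated vertex on `2`.
  let σ : Equiv.Perm (Fin 5) :=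
    { toFun := ![0, 1, 3, 4, 2]
      invFun := ![0, 1, 4, 2, 3]
      left_inv := by decide
      right_inv := by decide }
  have h : pathSum 4 * pathSum 1 = colorSum (fun κ : Fin 5 → ℕ+ =>
      κ 0 ≠ κ 1 ∧ κ 1 ≠ κ 3 ∧ κ 3 ≠ κ 4) := by
    rw [pathSum, pathSum, colorSum_mul]
    refine colorSum_equiv (finSumFinEquiv.trans σ) fun κ => ?_
    rw [smirnov_iff, smirnov_iff]
    simp only [Fin.forall_fin_succ, IsEmpty.forall_iff, and_true]
    exact Iff.rfl
  have h' : colorSum (fun κ : Fin 5 → ℕ+ => (κ 0 ≠ κ 1 ∧ κ 1 ≠ κ 3 ∧ κ 3 ≠ κ 4) ∧ κ 2 = κ 1) =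
      colorSum (fun κ : Fin 5 → ℕ+ => (κ 0 ≠ κ 1 ∧ κ 1 ≠ κ 3 ∧ κ 3 ≠ κ 4) ∧ κ 2 = κ 3) := by
    refine colorSum_equiv Fin.revPerm fun κ => ?_
    change (κ 4 ≠ κ 3 ∧ κ 3 ≠ κ 1 ∧ κ 1 ≠ κ 0) ∧ κ 2 = κ 3 ↔ _
    constructor <;> rintro ⟨⟨h1, h2, h3⟩, h4⟩ <;>
      exact ⟨⟨Ne.symm h3, Ne.symm h2, Ne.symm h1⟩, h4⟩
  rw [h, colorSum_split _ (fun κ => κ 2 = κ 1),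
    colorSum_split (fun κ : Fin 5 → ℕ+ => _ ∧ ¬ κ 2 = κ 1) (fun κ => κ 2 = κ 3), two_mul,
    add_assoc]
  congr 1
  rw [h']
  congr 1 <;> refine colorSum_congr fun κ => ?_
  · constructor
    · rintro ⟨⟨h1, -⟩, h3⟩
      exact ⟨h1, h3⟩
    · rintro ⟨⟨h1, h2, h3⟩, h4⟩
      exact ⟨⟨⟨h1, h2, h3⟩, fun h => h2 (h.symm.trans h4)⟩, h4⟩
  · constructor
    · rintro ⟨⟨⟨h1, h2, h3⟩, h4⟩, h5⟩
      exact ⟨h1, Ne.symm h4, h5, h3, h2⟩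
    · rintro ⟨h1, h2, h3, h4, h5⟩
      exact ⟨⟨⟨h1, h5, h4⟩, Ne.symm h2⟩, h3⟩

theorem colorSum_bull :
    colorSum BullProper =
      10 • elementarySymm 5 + 10 • (elementarySymm 4 * elementarySymm 1) +
        2 • (elementarySymm 3 * elementarySymm 2) +
        2 • (elementarySymm 3 * elementarySymm 1 * elementarySymm 1) := by
  -- With `U` for path colorings having `κ 1 = κ 3` and `T` for colorings of the path `0, 1, 3, 4`
  -- with `κ 2 = κ 1`, the splittings read `P_5 = U + X`, `P_2 P_3 = T + U + X` and `P_4 P_1 = 2T +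
  -- X`, where `X` is the bull; eliminate `T` and `U`.
  have h : colorSum BullProper =
      2 * pathSum 5 + pathSum 4 * pathSum 1 - 2 * (pathSum 2 * pathSum 3) := by
    rw [pathSum_five_eq_add, pathSum_two_mul_pathSum_three_eq_add,
      pathSum_four_mul_pathSum_one_eq_add]
    ring
  have h1 : pathSum 1 = elementarySymm 1 := by
    rw [pathSum_succ]
    simp
  have h2 : pathSum 2 = 2 * elementarySymm 2 := by
    rw [pathSum_succ]
    simp [sum_range_succ, pathSum_zero]
    ring
  have h3 : pathSum 3 = 3 * elementarySymm 3 + elementarySymm 2 * elementarySymm 1 := by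
    rw [pathSum_succ]
    simp [sum_range_succ, pathSum_zero, h1]
    ring
  have h4 : pathSum 4 = 4 * elementarySymm 4 + 2 * elementarySymm 2 * elementarySymm 2 +
      2 * elementarySymm 3 * elementarySymm 1 := by
    rw [pathSum_succ]
    simp [sum_range_succ, pathSum_zero, h1, h2]
    ring
  have h5 : pathSum 5 = 5 * elementarySymm 5 + 3 * elementarySymm 4 * elementarySymm 1 +
      7 * elementarySymm 3 * elementarySymm 2 +
      elementarySymm 2 * elementarySymm 2 * elementarySymm 1 := by
    rw [pathSum_succ]
    simp [sum_range_succ, pathSum_zero, h1, h2, h3]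
    ring
  rw [h, h5, h4, h3, h2, h1]
  simp only [nsmul_eq_mul]
  push_cast
  ring

theorem colorSum_bull_mem : colorSum BullProper ∈ ePositive := by
  rw [colorSum_bull]
  have h := elementarySymm_mem
  exact add_mem (add_mem (add_mem (nsmul_mem (h 5) _) (nsmul_mem (mul_mem (h 4) (h 1)) _))
    (nsmul_mem (mul_mem (h 3) (h 2)) _)) (nsmul_mem (mul_mem (mul_mem (h 3) (h 1)) (h 1)) _)

/-! ### The structure of co-claw-free unit interval graphs -/

/-- Every triangle dominates every other vertex. -/
def TrianglesDominate {V : Type*} (G : SimpleGraph V) : Prop :=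
  ∀ x y z w, G.Adj x y → G.Adj y z → G.Adj x z → w ≠ x → w ≠ y → w ≠ z →
    G.Adj w x ∨ G.Adj w y ∨ G.Adj w z

theorem TrianglesDominate.comap {V W : Type*} {G : SimpleGraph V} (h : TrianglesDominate G)
    {f : W → V} (hf : Function.Injective f) : TrianglesDominate (G.comap f) :=
  fun _ _ _ _ h1 h2 h3 h4 h5 h6 => h _ _ _ _ h1 h2 h3 (hf.ne h4) (hf.ne h5) (hf.ne h6)

section Sorted

variable {n : ℕ} {G : SimpleGraph (Fin n)} {a : Fin n → ℝ}

theorem IsUnitRep.adj_of_le (hrep : IsUnitRep G a) (ha : Monotone a) {i i' j' j : Fin n}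
    (h1 : i ≤ i') (h2 : i' < j') (h3 : j' ≤ j) (h : G.Adj i j) : G.Adj i' j' := by
  have h := ((hrep _ _).mp h).2
  refine (hrep _ _).mpr ⟨h2.ne, ?_⟩
  have h1 := ha h1
  have h2 := ha h2.le
  have h3 := ha h3
  rw [abs_le] at h ⊢
  constructor <;> linarith

/-- Of any three vertices two lie on the same side of `p`, so there is no stable triple. -/
theorem mem_ePositive_of_cliques (hrep : IsUnitRep G a) (p : ℕ)
    (h1 : ∀ i j : Fin n, i < j → j.val < p → G.Adj i j)
    (h2 : ∀ i j : Fin n, i < j → p ≤ i.val → G.Adj i j) :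
    colorSum (Proper G) ∈ ePositive := by
  refine mem_ePositive_of_inCone (inCone_of_isUnitRep G a (Fintype.card_fin n) hrep ?_)
  have key : ∀ u v : Fin n, u ≠ v → (u.val < p ↔ v.val < p) → G.Adj u v := by
    intro u v huv h
    rcases lt_or_gt_of_ne huv with hlt | hlt
    · by_cases hv : v.val < p
      · exact h1 u v hlt hv
      · exact h2 u v hlt (by omega)
    · by_cases hv : u.val < p
      · exact (h1 v u hlt hv).symm
      · exact (h2 v u hlt (by omega)).symm
  intro u v w huv huw hvw
  by_cases hu : u.val < p <;> by_cases hv : v.val < p <;> by_cases hw : w.val < p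
  all_goals first
    | exact Or.inl (key u v huv (by tauto))
    | exact Or.inr (Or.inl (key u w huw (by tauto)))
    | exact Or.inr (Or.inr (key v w hvw (by tauto)))

/-- Whichever triangle vertex `w` is adjacent to, `x` lies no farther away. -/
theorem TrianglesDominate.adj_left (hG : TrianglesDominate G) (hrep : IsUnitRep G a)
    (ha : Monotone a) {x y z w : Fin n} (hxy : x < y) (hyz : y < z) (h : G.Adj x z)
    (hw : w < x) : G.Adj w x := by
  rcases hG x y z w (hrep.adj_of_le ha le_rfl hxy hyz.le h)
    (hrep.adj_of_le ha hxy.le hyz le_rfl h) h hw.ne (hw.trans hxy).ne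
    (hw.trans (hxy.trans hyz)).ne with h | h | h
  · exact h
  · exact hrep.adj_of_le ha le_rfl hw hxy.le h
  · exact hrep.adj_of_le ha le_rfl hw (hxy.trans hyz).le h

theorem TrianglesDominate.adj_right (hG : TrianglesDominate G) (hrep : IsUnitRep G a)
    (ha : Monotone a) {x y z w : Fin n} (hxy : x < y) (hyz : y < z) (h : G.Adj x z)
    (hw : z < w) : G.Adj z w := by
  rcases hG x y z w (hrep.adj_of_le ha le_rfl hxy hyz.le h)
    (hrep.adj_of_le ha hxy.le hyz le_rfl h) h (hxy.trans (hyz.trans hw)).ne'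
    (hyz.trans hw).ne' hw.ne' with h | h | h
  · exact hrep.adj_of_le ha (hxy.trans hyz).le hw le_rfl h.symm
  · exact hrep.adj_of_le ha hyz.le hw le_rfl h.symm
  · exact h.symm

/-- The third vertex is adjacent to the last one, so everything from it onward is a clique. -/
theorem mem_ePositive_of_first_triangle (hrep : IsUnitRep G a) (ha : Monotone a)
    (hG : TrianglesDominate G) (hn : 2 < n)
    (h : G.Adj ⟨0, by omega⟩ ⟨2, hn⟩) : colorSum (Proper G) ∈ ePositive := by
  refine mem_ePositive_of_cliques hrep 2 (fun i j hij hj => ?_) fun i j hij hi => ?_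
  · exact hrep.adj_of_le ha (Fin.mk_le_of_le_val (Nat.zero_le _)) hij
      (Fin.le_def.mpr (by simpa using hj.le)) h
  · refine hrep.adj_of_le ha (Fin.mk_le_of_le_val hi) hij le_rfl
      (hG.adj_right hrep ha (x := ⟨0, by omega⟩) (y := ⟨1, by omega⟩) ?_ ?_ h ?_)
    · exact Fin.lt_def.mpr Nat.zero_lt_one
    · exact Fin.lt_def.mpr Nat.one_lt_two
    · exact Fin.lt_def.mpr (lt_of_le_of_lt hi hij)

theorem mem_ePositive_of_last_triangle (hrep : IsUnitRep G a) (ha : Monotone a)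
    (hG : TrianglesDominate G) (hn : 2 < n)
    (h : G.Adj ⟨n - 3, by omega⟩ ⟨n - 1, by omega⟩) : colorSum (Proper G) ∈ ePositive := by
  refine mem_ePositive_of_cliques hrep (n - 2) (fun i j hij hj => ?_) fun i j hij hi => ?_
  · have hij' := Fin.lt_def.mp hij
    refine hrep.adj_of_le ha le_rfl hij (j := ⟨n - 3, by omega⟩) (Fin.le_def.mpr (by dsimp; omega))
      (hG.adj_left hrep ha (y := ⟨n - 2, by omega⟩) (z := ⟨n - 1, by omega⟩) ?_ ?_ h ?_)
    all_goals
      refine Fin.lt_def.mpr ?_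
      dsimp
      omega
  · refine hrep.adj_of_le ha (Fin.mk_le_of_le_val (by omega)) hij
      (Fin.le_def.mpr ?_) h
    dsimp
    omega

theorem mem_ePositive_of_sorted (hrep : IsUnitRep G a) (ha : Monotone a)
    (hG : TrianglesDominate G) (hconn : ∀ i j : Fin n, i.val + 1 = j.val → G.Adj i j) :
    colorSum (Proper G) ∈ ePositive := by
  by_cases hpath : ∀ i j : Fin n, i.val + 2 = j.val → ¬ G.Adj i j
  · have hlt : ∀ i j : Fin n, i < j → G.Adj i j → i.val + 1 = j.val := by
      intro i j hij h
      have hij' := Fin.lt_def.mp hij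
      by_contra hne
      refine hpath i ⟨i.val + 2, by omega⟩ rfl
        (hrep.adj_of_le ha le_rfl (Fin.lt_def.mpr ?_) (Fin.le_def.mpr ?_) h) <;> dsimp <;> omega
    have : colorSum (Proper G) = pathSum n := by
      refine colorSum_congr fun κ => ⟨fun h i j hij => h _ _ (hconn i j hij), fun h i j hij => ?_⟩
      rcases lt_or_gt_of_ne hij.ne with hl | hl
      · exact h i j (hlt i j hl hij)
      · exact (h j i (hlt j i hl hij.symm)).symm
    rw [this]
    exact pathSum_mem n
  push Not at hpath
  obtain ⟨⟨i, hi⟩, ⟨j, hj⟩, hij, h⟩ := hpath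
  dsimp only at hij
  subst hij
  have hmid1 : (⟨i, hi⟩ : Fin n) < ⟨i + 1, by omega⟩ := Fin.lt_def.mpr (by dsimp; omega)
  have hmid2 : (⟨i + 1, by omega⟩ : Fin n) < ⟨i + 2, hj⟩ := Fin.lt_def.mpr (by dsimp; omega)
  by_cases h0 : i = 0
  · subst h0
    exact mem_ePositive_of_first_triangle hrep ha hG hj h
  by_cases h1 : i = 1
  · subst h1
    by_cases hn4 : n = 4
    · subst hn4
      exact mem_ePositive_of_last_triangle hrep ha hG (by omega) h
    by_cases hn5 : n = 5
    · subst hn5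
      by_cases h02 : G.Adj 0 2
      · exact mem_ePositive_of_first_triangle hrep ha hG (by omega) h02
      by_cases h24 : G.Adj 2 4
      · exact mem_ePositive_of_last_triangle hrep ha hG (by omega) h24
      have h03 : ¬ G.Adj 0 3 := fun h' => h02 (hrep.adj_of_le ha le_rfl (by decide) (by decide) h')
      have h04 : ¬ G.Adj 0 4 := fun h' => h02 (hrep.adj_of_le ha le_rfl (by decide) (by decide) h')
      have h14 : ¬ G.Adj 1 4 := fun h' => h24 (hrep.adj_of_le ha (by decide) (by decide) le_rfl h')
      have : colorSum (Proper G) = colorSum BullProper := by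
        refine colorSum_congr fun κ => ⟨fun hκ => ⟨hκ _ _ (hconn 0 1 rfl), hκ _ _ (hconn 1 2 rfl),
          hκ _ _ (hconn 2 3 rfl), hκ _ _ (hconn 3 4 rfl), hκ _ _ h⟩, ?_⟩
        rintro ⟨k1, k2, k3, k4, k5⟩
        have key : ∀ u v : Fin 5, u < v → G.Adj u v → κ u ≠ κ v := by
          intro u v huv hadj
          fin_cases u <;> fin_cases v <;>
            first
              | exact absurd huv (by decide)
              | assumption
              | exact absurd hadj (by assumption)
        intro u v huv
        rcases lt_or_gt_of_ne huv.ne with hl | hl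
        · exact key u v hl huv
        · exact (key v u hl huv.symm).symm
      rw [this]
      exact colorSum_bull_mem
    -- Here `n ≥ 6`, so the last three vertices lie between `3` and its neighbor `n - 1`.
    · have h3 : G.Adj ⟨3, hj⟩ ⟨n - 1, by omega⟩ :=
        hG.adj_right hrep ha hmid1 hmid2 h (Fin.lt_def.mpr (by dsimp; omega))
      refine mem_ePositive_of_last_triangle hrep ha hG (by omega)
        (hrep.adj_of_le ha ?_ ?_ le_rfl h3)
      · exact Fin.le_def.mpr (by dsimp; omega)
      · exact Fin.lt_def.mpr (by dsimp; omega)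
  -- Here `i ≥ 2`, so the first three vertices lie between `0` and its neighbor `i`.
  · have h3 : G.Adj ⟨0, by omega⟩ ⟨i, hi⟩ :=
      hG.adj_left hrep ha hmid1 hmid2 h (Fin.lt_def.mpr (by dsimp; omega))
    refine mem_ePositive_of_first_triangle hrep ha hG (by omega)
      (hrep.adj_of_le ha le_rfl ?_ ?_ h3)
    · exact Fin.lt_def.mpr (by dsimp; omega)
    · exact Fin.le_def.mpr (by dsimp; omega)

end Sorted

theorem mem_ePositive_of_isUnitRep {n : ℕ} : ∀ {V : Type*} [Fintype V] (G : SimpleGraph V)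
    (a : V → ℝ), Fintype.card V = n → IsUnitRep G a → TrianglesDominate G →
    colorSum (Proper G) ∈ ePositive := by
  classical
  induction n using Nat.strong_induction_on with
  | _ n ih =>
    intro V _ G a hV hrep hG
    by_cases hcut : ∃ p : V → Prop, (∃ u, p u) ∧ (∃ v, ¬ p v) ∧ ∀ u v, p u → ¬ p v → ¬ G.Adj u v
    · obtain ⟨p, ⟨u, hu⟩, ⟨v, hv⟩, hp⟩ := hcut
      rw [colorSum_proper_of_cut G p hp]
      refine mul_mem (ih _ ?_ _ _ rfl (hrep.comap Subtype.val_injective)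
        (hG.comap Subtype.val_injective)) (ih _ ?_ _ _ rfl (hrep.comap Subtype.val_injective)
        (hG.comap Subtype.val_injective))
      · rw [← hV]
        exact Fintype.card_subtype_lt hv
      · rw [← hV]
        exact Fintype.card_subtype_lt (x := u) (by simpa using hu)
    · let e₀ := (Fintype.equivFinOfCardEq hV).symm
      let e := (Tuple.sort (a ∘ e₀)).trans e₀
      have ha : Monotone (a ∘ e) := Tuple.monotone_sort (a ∘ e₀)
      have hrep' : IsUnitRep (G.comap e) (a ∘ e) := hrep.comap e.injective
      rw [← colorSum_proper_comap G e]
      refine mem_ePositive_of_sorted hrep' ha (hG.comap e.injective) fun i j hij => ?_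
      by_contra hadj
      -- An edge leaving the initial segment up to `i` would span the consecutive pair `i, j` and
      -- make it adjacent.
      refine hcut ⟨fun v => e.symm v ≤ i, ⟨e i, by simp⟩, ⟨e j, ?_⟩, fun u v hu hv huv => hadj ?_⟩
      · simp only [Equiv.symm_apply_apply, not_le]
        exact Fin.lt_def.mpr (by omega)
      · have h : (G.comap e).Adj (e.symm u) (e.symm v) := by simpa using huv
        refine hrep'.adj_of_le ha hu (Fin.lt_def.mpr (by omega)) ?_ h
        have := Fin.lt_def.mp (not_le.mp hv)
        exact Fin.le_def.mpr (by omega)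

/-! ### From the stated hypotheses to distances and dominating triangles -/

theorem IsUnitIntervalGraph.exists_isUnitRep {V : Type*} {G : SimpleGraph V}
    (h : IsUnitIntervalGraph G) : ∃ a, IsUnitRep G a := by
  obtain ⟨a, ha⟩ := h
  refine ⟨a, fun u v => ?_⟩
  by_cases huv : u = v
  · subst huv
    simp
  · rw [ha u v huv, Set.Icc_inter_Icc, Set.nonempty_Icc, abs_le]
    simp only [sup_le_iff, le_inf_iff, huv, ne_eq, not_false_eq_true, true_and]
    constructor
    · rintro ⟨⟨_, h1⟩, h2, _⟩
      constructor <;> linarith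
    · rintro ⟨h1, h2⟩
      refine ⟨⟨?_, ?_⟩, ?_, ?_⟩ <;> linarith

theorem IsCoclawFree.trianglesDominate {V : Type*} {G : SimpleGraph V} (h : IsCoclawFree G) :
    TrianglesDominate G := by
  intro x y z w hxy hyz hxz hwx hwy hwz
  by_contra! hc
  obtain ⟨h1, h2, h3⟩ := hc
  refine h ⟨⟨⟨Sum.elim (fun _ => w) ![x, y, z], ?_⟩, ?_⟩⟩
  · rintro (i | i) (j | j) hij
    · rw [Subsingleton.elim i j]
    · fin_cases j <;> simp_all
    · fin_cases i <;> simp_all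
    · have := hxy.ne
      have := hyz.ne
      have := hxz.ne
      fin_cases i <;> fin_cases j <;> simp_all
  · intro i j
    change G.Adj (Sum.elim (fun _ => w) ![x, y, z] i) (Sum.elim (fun _ => w) ![x, y, z] j) ↔ _
    rcases i with i | i <;> rcases j with j | j
    · simp [coclaw, claw, Subsingleton.elim i j]
    · fin_cases j <;> simp [coclaw, claw, h1, h2, h3]
    · fin_cases i <;> simp [coclaw, claw, G.adj_comm _ w, h1, h2, h3]
    · fin_cases i <;> fin_cases j <;>
        simp [coclaw, claw, hxy, hyz, hxz, hxy.symm, hyz.symm, hxz.symm]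

end ChromaticSymm

end

theorem theorem3p9 {V : Type*} [Fintype V] (G : SimpleGraph V)
    (hG : ChromaticSymm.IsUnitIntervalGraph G) (hfree : ChromaticSymm.IsCoclawFree G) :
    ChromaticSymm.IsEPositive (ChromaticSymm.chromaticSymmetricFunction G) := by
  obtain ⟨a, ha⟩ := hG.exists_isUnitRep
  rw [ChromaticSymm.chromaticSymmetricFunction_eq]
  exact ChromaticSymm.isEPositive_of_mem
    (ChromaticSymm.mem_ePositive_of_isUnitRep G a rfl ha hfree.trianglesDominate)
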